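/- **Definitions.** A *Cayley circuit* is a directed acyclic graph with topologically ordered vertices (*gates*), multi-edges allowed, in which every gate has in-degree $0$ (*input gate*) or $2$ (*product gate*); the last gate is the *output gate*, and the *size* is the number of gates. Given a semigroup $S$ and elements $x_1,\dots,x_k\in S$ for the $k$ input gates, each product gate computes the product in $S$ of the values of its two predecessors, and $\mathcal C(S,x_1,\dots,x_k)$ denotes the value of the output gate. A class $\mathbf V$ of finite semigroups has the *poly-logarithmic circuits property* if there is a constant $c\in\mathbb N$ such that for every $S\in\mathbf V$ with $N$ elements, every $X\subseteq S$ and every $y$ in the subsemigroup generated by $X$, there are a Cayley circuit $\mathcal C$ of size at most $(\lfloor\log_2 N\rfloor+2)^c$ and inputs $x_1,\dots,x_k\in X$ with $\mathcal C(S,x_1,\dots,x_k)=y$. For a class $\mathbf V$ of finite semigroups, $\mathrm{CSM}(\mathbf V)$ is the following (promise) problem: given the Cayley table of a semigroup $S\in\mathbf V$, a set $X\subseteq S$ and an element $t\in S$, is $t$ in the subsemigroup of $S$ generated by $X$? Here the $N$ elements of $S$ are numbered $0,\dots,N-1$ in an arbitrary way, an element is encoded by $\lceil\log_2 N\rceil$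 bits, $S$ by its table of $N^2$ entries, and $X$ by its characteristic vector of $N$ bits. A function $\{0,1\}^*\to\{0,1\}^*$ is $\mathsf{AC}^0$-computable if it is computed by a family (one circuit for each input length) of Boolean circuits with NOT gates and unbounded fan-in AND and OR gates, of constant depth and polynomial size, with polynomially many outputs; NOT gates count neither for the depth nor for the size. A language $L\subseteq\{0,1\}^*$ is $\mathsf{AC}^0$ many-one reducible to $\mathrm{CSM}(\mathbf V)$ if an $\mathsf{AC}^0$-computable function maps every word in $L$ to the encoding of a positive instance, and every word not in $L$ to the encoding of a negative instance, of $\mathrm{CSM}(\mathbf V)$. The problem $\mathrm{CSM}(\mathbf V)$ is *hard* for a class $\mathcal K$ of languages if every $L\in\mathcal K$ is $\mathsf{AC}^0$ many-one reducible to it. $\mathrm{PARITY}$ is the set of words over $\{0,1\}$ with an odd number of ones. **Corollary.** 1. Let $\mathbf V$ be a class of finite semigroups with the poly-logarithmic circuits property. Then $\mathrm{CSM}(\mathbf V)$ is not hard for any class $\mathcal K$ of languages with $\mathrm{PARITY}\in\mathcal K$. 2. The class $\mathbf G$ of all finite groups and the class $\mathbf{Com}$ of all finite commutative semigroups have the poly-logarithmic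 circuits property. 3. $\mathrm{PARITY}$ belongs to the (non-uniform) circuit classes $\mathsf{ACC}^0$, $\mathsf{TC}^0$ and $\mathsf{NC}^1$, and to $\mathsf L$ (deterministic logarithmic space) and $\mathsf{NL}$ (nondeterministic logarithmic space). In particular, neither $\mathrm{CSM}(\mathbf G)$ nor $\mathrm{CSM}(\mathbf{Com})$, nor $\mathrm{CSM}(\mathbf V)$ for any other $\mathbf V$ as in 1, is hard for $\mathsf{ACC}^0$, $\mathsf{TC}^0$, $\mathsf{NC}^1$, $\mathsf L$ or $\mathsf{NL}$. -/

import Mathlib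

universe u

namespace CayleySemigroup

/-! ### Cayley circuits -/

/-- A Cayley circuit. The gates are `0, …, size - 1` in topological order; `gate i = none` says that
gate `i` is an input gate, `gate i = some (p, q)` that it is a product gate with (possibly equal)
predecessors `p, q < i`. The output gate is the last gate. -/
structure CayleyCircuit where
  size : ℕ
  size_pos : 0 < size
  gate : (i : Fin size) → Option (Fin i × Fin i)

namespace CayleyCircuit

/-- The input gates of a Cayley circuit. -/
abbrev InputGate (C : CayleyCircuit) : Type := {i : Fin C.size // C.gate i = none}

/-- The value of a gate, given the values of the input gates. -/
def gateVal (C : CayleyCircuit) {S : Type u} [Semigroup S] (x : C.InputGate → S)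
    (i : Fin C.size) : S :=
  match h : C.gate i with
  | none => x ⟨i, h⟩
  | some (p, q) =>
      C.gateVal x ⟨p, p.isLt.trans i.isLt⟩ * C.gateVal x ⟨q, q.isLt.trans i.isLt⟩
termination_by i.val
decreasing_by
  · exact p.isLt
  · exact q.isLt

/-- The value of the circuit: the value of its output gate. -/
def eval (C : CayleyCircuit) {S : Type u} [Semigroup S] (x : C.InputGate → S) : S :=
  C.gateVal x ⟨C.size - 1, Nat.sub_lt C.size_pos Nat.one_pos⟩

end CayleyCircuit

/-! ### Classes of finite semigroups -/

/-- A class of semigroups. Only its finite members matter below. -/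
abbrev SemigroupClass : Type (u + 1) := (S : Type u) → [Semigroup S] → Prop

/-- The class of (finite) groups. -/
def groupClass : SemigroupClass.{u} := fun S _ =>
  ∃ (G : Type u) (_ : Group G), Nonempty (S ≃* G)

/-- The class of (finite) commutative semigroups. -/
def comClass : SemigroupClass.{u} := fun S _ => ∀ a b : S, a * b = b * a

/-- The poly-logarithmic circuits property: there is a constant `c` such that, in each member of
the class with `N` elements, every element of the subsemigroup generated by a set `X` is
the value of a Cayley circuit with at most `(⌊log₂ N⌋ + 2) ^ c` gates and inputs from `X`. -/
def HasPolylogCircuits (V : SemigroupClass.{u}) : Prop :=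
  ∃ c : ℕ, ∀ (S : Type u) [Semigroup S] [Finite S], V S →
    ∀ (X : Set S) (y : S), y ∈ Subsemigroup.closure X →
      ∃ C : CayleyCircuit, C.size ≤ (Nat.log 2 (Nat.card S) + 2) ^ c ∧
        ∃ x : C.InputGate → S, (∀ i, x i ∈ X) ∧ C.eval x = y

/-! ### The Cayley semigroup membership problem -/

/-- The encoding of an element of `{0, …, N - 1}` by `⌈log₂ N⌉` bits. -/
def encodeElt {N : ℕ} (a : Fin N) : List Bool :=
  List.ofFn fun j : Fin (Nat.clog 2 N) => (a : ℕ).testBit j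

open Classical in
/-- The encoding of a multiplication table (`N ^ 2` entries), a subset of `{0, …, N - 1}`
(its characteristic vector of `N` bits) and an element. -/
noncomputable def encodeCSM {N : ℕ} (mul : Fin N → Fin N → Fin N) (X : Set (Fin N)) (t : Fin N) :
    List Bool :=
  ((List.finRange N).flatMap fun a => (List.finRange N).flatMap fun b => encodeElt (mul a b)) ++
    (List.ofFn fun a => decide (a ∈ X)) ++ encodeElt t

/-- A promise problem: the words that encode a positive, respectively a negative, instance. -/
structure PromiseProblem where
  yes : Set (List Bool)
  no : Set (List Bool)

/-- The encoding of the instance `(S, X, t)` under the numbering `e` of the elements of `S`. -/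
noncomputable def encodeInstance {S : Type u} [Semigroup S] {N : ℕ} (e : S ≃ Fin N) (X : Set S)
    (t : S) : List Bool :=
  encodeCSM (fun a b => e (e.symm a * e.symm b)) (e '' X) (e t)

/-- `CSM(V)`: given the Cayley table of a finite semigroup `S` in `V`, a subset `X` of `S` and
`t` in `S`, is `t` in the subsemigroup of `S` generated by `X`? -/
def CSM (V : SemigroupClass.{u}) : PromiseProblem where
  yes := {w | ∃ (S : Type u) (_ : Semigroup S) (N : ℕ) (e : S ≃ Fin N) (X : Set S) (t : S),
    V S ∧ t ∈ Subsemigroup.closure X ∧ w = encodeInstance e X t}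
  no := {w | ∃ (S : Type u) (_ : Semigroup S) (N : ℕ) (e : S ≃ Fin N) (X : Set S) (t : S),
    V S ∧ t ∉ Subsemigroup.closure X ∧ w = encodeInstance e X t}

/-! ### Boolean circuits -/

/-- Gates whose incoming wires come from `W`. -/
inductive Gate (W : Type) where
  | not (w : W)
  | and (s : Finset W)
  | or (s : Finset W)
  | mod (m : ℕ) (s : Finset W)
  | maj (s : Finset W)

namespace Gate

variable {W : Type}

/-- A MOD-`m` gate tests whether the number of ones is divisible by `m`, a MAJ gate whether at
least half of the incoming values are ones. -/
def eval (v : W → Bool) : Gate W → Bool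
  | not w => !v w
  | and s => decide (∀ w ∈ s, v w = true)
  | or s => decide (∃ w ∈ s, v w = true)
  | mod m s => decide (m ∣ (s.filter fun w => v w = true).card)
  | maj s => decide (s.card ≤ 2 * (s.filter fun w => v w = true).card)

/-- NOT gates are not counted in the depth. -/
def depth (d : W → ℕ) : Gate W → ℕ
  | not w => d w
  | and s => s.sup d + 1
  | or s => s.sup d + 1
  | mod _ s => s.sup d + 1
  | maj s => s.sup d + 1

/-- NOT gates are not counted in the size. -/
def cost : Gate W → ℕ
  | not _ => 0
  | _ => 1

/-- NOT, and AND and OR of unbounded fan-in. -/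
def IsAC : Gate W → Prop
  | not _ => True
  | and _ => True
  | or _ => True
  | mod _ _ => False
  | maj _ => False

/-- NOT, and AND, OR and MOD-`m` of unbounded fan-in. -/
def IsACC (m : ℕ) : Gate W → Prop
  | not _ => True
  | and _ => True
  | or _ => True
  | mod m' _ => m' = m
  | maj _ => False

/-- NOT, and AND, OR and MAJ of unbounded fan-in. -/
def IsTC : Gate W → Prop
  | not _ => True
  | and _ => True
  | or _ => True
  | mod _ _ => False
  | maj _ => True

/-- NOT, and AND and OR of fan-in at most two. -/
def IsNC : Gate W → Prop
  | not _ => True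
  | and s => s.card ≤ 2
  | or s => s.card ≤ 2
  | mod _ _ => False
  | maj _ => False

end Gate

/-- A Boolean circuit with `n` inputs and `m` outputs. The gates are `0, …, numGates - 1` in
topological order; the wires into gate `i` come from inputs (`Sum.inl`) or from earlier gates
(`Sum.inr`). -/
structure Circuit (n m : ℕ) where
  numGates : ℕ
  gate : (i : Fin numGates) → Gate (Fin n ⊕ Fin i)
  output : Fin m → Fin n ⊕ Fin numGates

namespace Circuit

variable {n m : ℕ}

/-- The value of a gate. -/
def gateVal (C : Circuit n m) (x : Fin n → Bool) (i : Fin C.numGates) : Bool :=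
  (C.gate i).eval fun w =>
    match w with
    | Sum.inl j => x j
    | Sum.inr p => C.gateVal x ⟨p, p.isLt.trans i.isLt⟩
termination_by i.val
decreasing_by exact p.isLt

/-- The output of a circuit. -/
def eval (C : Circuit n m) (x : Fin n → Bool) (j : Fin m) : Bool :=
  Sum.elim x (C.gateVal x) (C.output j)

/-- The depth of a gate. -/
def gateDepth (C : Circuit n m) (i : Fin C.numGates) : ℕ :=
  (C.gate i).depth fun w =>
    match w with
    | Sum.inl _ => 0
    | Sum.inr p => C.gateDepth ⟨p, p.isLt.trans i.isLt⟩
termination_by i.val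
decreasing_by exact p.isLt

/-- The depth of a circuit. -/
def depth (C : Circuit n m) : ℕ := Finset.univ.sup C.gateDepth

/-- The size of a circuit. -/
def size (C : Circuit n m) : ℕ := ∑ i, (C.gate i).cost

end Circuit

/-- The circuit family `C` decides the language `L`. -/
def Decides (C : (n : ℕ) → Circuit n 1) (L : Language Bool) : Prop :=
  ∀ w : List Bool, (C w.length).eval w.get 0 = true ↔ w ∈ L

/-- Constant depth, polynomial size, and MOD-`m` gates for one fixed `m`. -/
def ACC0 : Set (Language Bool) :=
  {L | ∃ (C : (n : ℕ) → Circuit n 1) (m d k : ℕ), 2 ≤ m ∧ Decides C L ∧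
    ∀ n, (∀ i, ((C n).gate i).IsACC m) ∧ (C n).depth ≤ d ∧ (C n).size ≤ n ^ k + k}

/-- Constant depth, polynomial size, with majority gates. -/
def TC0 : Set (Language Bool) :=
  {L | ∃ (C : (n : ℕ) → Circuit n 1) (d k : ℕ), Decides C L ∧
    ∀ n, (∀ i, ((C n).gate i).IsTC) ∧ (C n).depth ≤ d ∧ (C n).size ≤ n ^ k + k}

/-- Logarithmic depth, polynomial size, bounded fan-in. -/
def NC1 : Set (Language Bool) :=
  {L | ∃ (C : (n : ℕ) → Circuit n 1) (d k : ℕ), Decides C L ∧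
    ∀ n, (∀ i, ((C n).gate i).IsNC) ∧ (C n).depth ≤ d * (Nat.log 2 n + 1) ∧
      (C n).size ≤ n ^ k + k}

/-! ### Many-one reductions and hardness -/

/-- Functions computable by `AC⁰` circuit families: constant depth, polynomial size, and
polynomially many output bits, their number depending on the input length only. -/
def AC0Computable (f : List Bool → List Bool) : Prop :=
  ∃ (m : ℕ → ℕ) (C : (n : ℕ) → Circuit n (m n)) (d k : ℕ),
    (∀ n, (∀ i, ((C n).gate i).IsAC) ∧ (C n).depth ≤ d ∧ (C n).size ≤ n ^ k + k ∧
      m n ≤ n ^ k + k) ∧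
    ∀ w : List Bool, f w = List.ofFn ((C w.length).eval w.get)

/-- `AC⁰` many-one reducibility of a language to a promise problem: all words are mapped to
valid instances. -/
def AC0Reduces (L : Language Bool) (P : PromiseProblem) : Prop :=
  ∃ f : List Bool → List Bool, AC0Computable f ∧
    ∀ w, (w ∈ L → f w ∈ P.yes) ∧ (w ∉ L → f w ∈ P.no)

/-- `P` is hard for the class `K` of languages under `AC⁰` many-one reductions. -/
def IsHardFor (P : PromiseProblem) (K : Set (Language Bool)) : Prop :=
  ∀ L ∈ K, AC0Reduces L P

/-- The words with an odd number of ones. -/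
def Parity : Language Bool := {w | Odd (w.count true)}

/-! ### Logarithmic space -/

/-- What the input head reads: an end marker or an input bit. -/
inductive InputSymbol where
  | left
  | bit (b : Bool)
  | right

/-- Head movements. -/
inductive Move where
  | left
  | stay
  | right

/-- A nondeterministic Turing machine with a two-way read-only input tape and one work tape
(infinite to the right). -/
structure Machine where
  State : Type
  Symbol : Type
  finite_state : Finite State
  finite_symbol : Finite Symbol
  start : State
  accepting : Set State
  blank : Symbol
  /-- The possible actions: new state, symbol written on the work tape, movement of the input
  head, movement of the work head. -/
  δ : State → InputSymbol → Symbol → Set (State × Symbol × Move × Move)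

namespace Machine

variable (M : Machine)

/-- Configurations. -/
@[ext] structure Config where
  state : M.State
  inputHead : ℕ
  workHead : ℕ
  tape : ℕ → M.Symbol

/-- The symbol in cell `p` of the input tape with input `w`: the left end marker is in cell `0`,
the input in cells `1, …, |w|`, the right end marker in cell `|w| + 1`. -/
def readInput (w : List Bool) : ℕ → InputSymbol
  | 0 => .left
  | p + 1 => match w[p]? with
    | some b => .bit b
    | none => .right

/-- Movement of a head on cells `0, …, bound` (it stays where it is rather than leave them). -/
def moveInput (bound : ℕ) (p : ℕ) : Move → ℕ
  | .left => p - 1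
  | .stay => p
  | .right => min (p + 1) bound

/-- Movement of the head on the work tape. -/
def moveWork (p : ℕ) : Move → ℕ
  | .left => p - 1
  | .stay => p
  | .right => p + 1

/-- The initial configuration. -/
def init : M.Config := ⟨M.start, 0, 0, fun _ => M.blank⟩

/-- One step of computation on input `w`. -/
def Step (w : List Bool) (c c' : M.Config) : Prop :=
  ∃ q s a b, (q, s, a, b) ∈ M.δ c.state (readInput w c.inputHead) (c.tape c.workHead) ∧
    c' = ⟨q, moveInput (w.length + 1) c.inputHead a, moveWork c.workHead b,
      Function.update c.tape c.workHead s⟩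

/-- Reachability from the initial configuration. -/
def Reaches (w : List Bool) (c : M.Config) : Prop := Relation.ReflTransGen (M.Step w) M.init c

/-- Some computation on `w` enters an accepting state. -/
def Accepts (w : List Bool) : Prop := ∃ c, M.Reaches w c ∧ c.state ∈ M.accepting

/-- All computations on `w` are finite. -/
def HaltsOn (w : List Bool) : Prop :=
  ¬ ∃ c : ℕ → M.Config, c 0 = M.init ∧ ∀ i, M.Step w (c i) (c (i + 1))

/-- On every input, all computations are finite and visit logarithmically many cells of the work
tape. -/
def IsLogspace : Prop :=
  ∃ k : ℕ, ∀ w : List Bool, M.HaltsOn w ∧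
    ∀ c, M.Reaches w c → c.workHead + 1 ≤ k * (Nat.log 2 w.length + 1)

/-- In each situation there is at most one action. -/
def IsDeterministic : Prop := ∀ q a s, (M.δ q a s).Subsingleton

end Machine

/-- Nondeterministic logarithmic space. -/
def NLogspace : Set (Language Bool) :=
  {L | ∃ M : Machine, M.IsLogspace ∧ ∀ w, M.Accepts w ↔ w ∈ L}

/-- Deterministic logarithmic space. -/
def Logspace : Set (Language Bool) :=
  {L | ∃ M : Machine, M.IsDeterministic ∧ M.IsLogspace ∧ ∀ w, M.Accepts w ↔ w ∈ L}

end CayleySemigroup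

namespace CayleySemigroup

/-! ### Straight-line programs -/

/-! For the lower bound, a small Cayley circuit is a short certificate of membership. It suffices to
read the characteristic bit of `X` for each input gate, the table entry used by each product gate,
and the bits of the target. Every instance with an encoding of the same length that agrees in these
polylogarithmically many positions is again positive (`exists_certificate`). So if `AC⁰` circuits
reduced parity to `CSM V`, each odd word `a` would come with a polylogarithmic set of output bits
that no even word reproduces, and parity would be a disjunction, over all odd `a`, of small
conjunctions of (negated) outputs of these circuits.

This is refuted by the method of Razborov and Smolensky over the field with three elements
(`le_of_parity_certificates`). The disjunction may have exponentially many terms, but approximating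
it costs a degree factor and an error that do not depend on the fan-in. Hence a function of
polylogarithmic degree would agree with the parity character on three quarters of the cube. On such
a set every function would have degree at most half the number of variables plus a polylogarithmic
term, and there are too few monomials for that (`card_le_of_eq_character_univ`,
`card_filter_card_le`).

In a finite commutative semigroup, a product of powers with the fewest generators involves only
logarithmically many, and powers are computed by repeated squaring. In a finite group, sets of
cheaply computable elements are doubled until their quotients cover the generated subsemigroup. The
memberships of parity are direct constructions: a negated MOD-2 gate, exact counting by thresholds,
a balanced tree of exclusive ors, and a one-pass automaton. -/

/-- `IsProgram X L`: each entry of `L` is an element of `X` or a product of two later entries. -/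
inductive IsProgram {S : Type u} [Mul S] (X : Set S) : List S → Prop
  | nil : IsProgram X []
  | input {L : List S} {x : S} : IsProgram X L → x ∈ X → IsProgram X (x :: L)
  | mul {L : List S} {a b : S} : IsProgram X L → a ∈ L → b ∈ L → IsProgram X (a * b :: L)

/-- A sequence whose terms lie in `X` or are products of two earlier terms is computed by
a Cayley circuit. -/
theorem exists_circuit_of_sequence {S : Type u} [Semigroup S] {X : Set S} {n : ℕ} (hn : 0 < n)
    (v : Fin n → S)
    (H : ∀ i, v i ∈ X ∨ ∃ p q : Fin i, v i = v (p.castLT (p.isLt.trans i.isLt)) *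
      v (q.castLT (q.isLt.trans i.isLt))) :
    ∃ C : CayleyCircuit, C.size = n ∧
      ∃ x : C.InputGate → S, (∀ i, x i ∈ X) ∧ C.eval x = v ⟨n - 1, Nat.sub_lt hn Nat.one_pos⟩ := by
  have hg : ∀ i : Fin n, ∃ g : Option (Fin i × Fin i), (g = none → v i ∈ X) ∧
      ∀ p q, g = some (p, q) → v i = v (p.castLT (p.isLt.trans i.isLt)) *
        v (q.castLT (q.isLt.trans i.isLt)) := by
    intro i
    rcases H i with h | ⟨p, q, h⟩
    · exact ⟨none, fun _ => h, by simp⟩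
    · refine ⟨some (p, q), by simp, ?_⟩
      rintro p' q' h'
      simp only [Option.some.injEq, Prod.mk.injEq] at h'
      rw [← h'.1, ← h'.2, h]
  choose g hg1 hg2 using hg
  let C : CayleyCircuit := ⟨n, hn, g⟩
  refine ⟨C, rfl, fun i => v i.1, fun i => hg1 _ i.2, ?_⟩
  have key : ∀ m, ∀ i : Fin C.size, i.val = m → C.gateVal (fun i => v i.1) i = v i := by
    intro m
    induction m using Nat.strong_induction_on with
    | _ m ih =>
      intro i hi
      rw [CayleyCircuit.gateVal]
      split
      · rfl
      · rename_i p q h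
        rw [ih p.val (hi ▸ p.isLt) ⟨p, _⟩ rfl, ih q.val (hi ▸ q.isLt) ⟨q, _⟩ rfl]
        exact (hg2 i p q h).symm
  exact key _ _ rfl

namespace IsProgram

variable {S : Type u}

/-- Programs grow at the head of the list, so reversal puts the entries in the topological order
that circuits require. -/
theorem sequence [Mul S] {X : Set S} {L : List S} (h : IsProgram X L) (i : Fin L.length) :
    L.reverse[i.val]'(by simp) ∈ X ∨ ∃ p q : Fin i, L.reverse[i.val]'(by simp) =
      L.reverse[p.val]'(by simpa using p.isLt.trans i.isLt) *
      L.reverse[q.val]'(by simpa using q.isLt.trans i.isLt) := by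
  have old : ∀ {L : List S} (x : S), (∀ i : Fin L.length,
      L.reverse[i.val]'(by simp) ∈ X ∨ ∃ p q : Fin i, L.reverse[i.val]'(by simp) =
      L.reverse[p.val]'(by simpa using p.isLt.trans i.isLt) *
      L.reverse[q.val]'(by simpa using q.isLt.trans i.isLt)) →
      ∀ i : Fin (x :: L).length, i.val < L.length →
      (x :: L).reverse[i.val]'(by rw [List.length_reverse]; exact i.isLt) ∈ X ∨ ∃ p q : Fin i,
      (x :: L).reverse[i.val]'(by rw [List.length_reverse]; exact i.isLt) =
      (x :: L).reverse[p.val]'(by simpa using p.isLt.trans i.isLt) *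
      (x :: L).reverse[q.val]'(by simpa using q.isLt.trans i.isLt) := by
    intro L x ih i hi
    simp only [List.reverse_cons]
    rw [List.getElem_append_left (by simpa using hi)]
    rcases ih ⟨i, hi⟩ with h | ⟨p, q, h⟩
    · exact Or.inl h
    · refine Or.inr ⟨p, q, ?_⟩
      rw [List.getElem_append_left (by simpa using p.isLt.trans hi),
        List.getElem_append_left (by simpa using q.isLt.trans hi)]
      exact h
  induction h with
  | nil => exact i.elim0
  | @input L x h hx ih =>
    rcases (Nat.lt_succ_iff.1 i.isLt).lt_or_eq with hi | hi
    · exact old x ih i hi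
    · left
      simp only [List.reverse_cons]
      rw [List.getElem_append_right (by simp [hi])]
      simpa using hx
  | @mul L a b h ha hb ih =>
    rcases (Nat.lt_succ_iff.1 i.isLt).lt_or_eq with hi | hi
    · exact old _ ih i hi
    · right
      obtain ⟨p, hp, rfl⟩ := List.getElem_of_mem (List.mem_reverse.2 ha)
      obtain ⟨q, hq, rfl⟩ := List.getElem_of_mem (List.mem_reverse.2 hb)
      rw [List.length_reverse] at hp hq
      refine ⟨⟨p, by omega⟩, ⟨q, by omega⟩, ?_⟩
      simp only [List.reverse_cons]
      rw [List.getElem_append_right (by simp [hi]), List.getElem_append_left (by simpa using hp),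
        List.getElem_append_left (by simpa using hq)]
      simp

/-- Discarding whatever was computed after `y` leaves a program whose final result is `y`, as needed
for an output gate in last position. -/
theorem exists_cons [Mul S] {X : Set S} {L : List S} (h : IsProgram X L) {y : S} (hy : y ∈ L) :
    ∃ L', IsProgram X (y :: L') ∧ L'.length + 1 ≤ L.length := by
  induction h with
  | nil => simp at hy
  | @input L x h hx ih =>
    rcases List.mem_cons.1 hy with rfl | hy
    · exact ⟨L, h.input hx, le_rfl⟩
    · obtain ⟨L', h', hl⟩ := ih hy
      exact ⟨L', h', hl.trans (Nat.le_succ _)⟩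
  | @mul L a b h ha hb ih =>
    rcases List.mem_cons.1 hy with rfl | hy
    · exact ⟨L, h.mul ha hb, le_rfl⟩
    · obtain ⟨L', h', hl⟩ := ih hy
      exact ⟨L', h', hl.trans (Nat.le_succ _)⟩

theorem exists_circuit [Semigroup S] {X : Set S} {L : List S} (h : IsProgram X L) {y : S}
    (hy : y ∈ L) :
    ∃ C : CayleyCircuit, C.size ≤ L.length ∧
      ∃ x : C.InputGate → S, (∀ i, x i ∈ X) ∧ C.eval x = y := by
  obtain ⟨L', h', hl⟩ := h.exists_cons hy
  obtain ⟨C, hC, x, hx, hy⟩ := exists_circuit_of_sequence (X := X) (n := (y :: L').length)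
    (by simp) (fun i => (y :: L').reverse[i.val]'(by rw [List.length_reverse]; exact i.isLt)) h'.sequence
  refine ⟨C, by simpa [hC] using hl, x, hx, hy.trans ?_⟩
  simp

theorem map {T : Type u} [Mul S] [Mul T] {X : Set S} {L : List S} (h : IsProgram X L)
    (f : S →ₙ* T) {Y : Set T} (hf : ∀ x ∈ X, f x ∈ Y) : IsProgram Y (L.map f) := by
  induction h with
  | nil => exact .nil
  | input h hx ih => exact ih.input (hf _ hx)
  | mul h ha hb ih =>
    rw [List.map_cons, map_mul]
    exact ih.mul (List.mem_map_of_mem ha) (List.mem_map_of_mem hb)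

/-- Powers are computed by repeated squaring. -/
theorem exists_pow [Mul S] {M : Type*} [Monoid M] (φ : S →ₙ* M) {X : Set S} {L : List S}
    (h : IsProgram X L) {x : S} (hx : x ∈ L) {n : ℕ} (hn : 0 < n) :
    ∃ L', IsProgram X L' ∧ L ⊆ L' ∧ L'.length ≤ L.length + 2 * Nat.log 2 n ∧
      ∃ z ∈ L', φ z = φ x ^ n := by
  induction n using Nat.strong_induction_on with
  | _ n ih =>
    rcases (Nat.succ_le_iff.2 hn).lt_or_eq with h1 | rfl
    -- Each halving of the exponent costs at most two products: a squaring and, for odd `n`, one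
    -- further factor `x`. Powers are read through `φ` because `S` need not have an identity.
    · obtain ⟨L', h', hs, hl, z, hz, e⟩ := ih (n / 2) (by omega) (by omega)
      have hlog : Nat.log 2 n = Nat.log 2 (n / 2) + 1 := Nat.log_of_one_lt_of_le (by omega) h1
      rcases Nat.even_or_odd' n with ⟨m, hm | hm⟩
      · refine ⟨z * z :: L', h'.mul hz hz, fun a ha => List.mem_cons_of_mem _ (hs ha), ?_,
          z * z, List.mem_cons_self, ?_⟩
        · rw [List.length_cons]; omega
        · rw [map_mul, e, ← pow_add]; congr 1; omega
      · refine ⟨z * z * x :: z * z :: L', (h'.mul hz hz).mul List.mem_cons_self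
          (List.mem_cons_of_mem _ (hs hx)), fun a ha => List.mem_cons_of_mem _
          (List.mem_cons_of_mem _ (hs ha)), ?_, _, List.mem_cons_self, ?_⟩
        · rw [List.length_cons, List.length_cons]; omega
        · rw [map_mul, map_mul, e, ← pow_add, ← pow_succ]; congr 1; omega
    · exact ⟨L, h, fun _ => id, by simp, x, hx, by simp⟩

end IsProgram

/-! ### Commutative semigroups -/

/-- In a finite monoid, each power is a power with a small positive exponent. -/
theorem exists_pow_eq_pow_le_card {M : Type*} [Monoid M] [Finite M] (x : M) {n : ℕ} (hn : 0 < n) :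
    ∃ m, 0 < m ∧ m ≤ Nat.card M ∧ x ^ m = x ^ n := by
  classical
  have hex : ∃ m, 0 < m ∧ x ^ m = x ^ n := ⟨n, hn, rfl⟩
  obtain ⟨hpos, heq⟩ := Nat.find_spec hex
  refine ⟨Nat.find hex, hpos, ?_, heq⟩
  -- Two equal powers below the least suitable exponent would allow the segment between them to be
  -- cut out, giving a smaller one.
  have hinj : Function.Injective fun i : Fin (Nat.find hex) => x ^ (i.val + 1) := by
    have aux : ∀ i j : ℕ, i < j → j < Nat.find hex → x ^ (i + 1) ≠ x ^ (j + 1) := by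
      intro i j hij hj h
      refine Nat.find_min hex (m := i + 1 + (Nat.find hex - (j + 1))) (by omega) ⟨by omega, ?_⟩
      rw [pow_add, h, ← pow_add, Nat.add_sub_cancel' (Nat.succ_le_iff.2 hj), heq]
    intro i j h
    rcases lt_trichotomy i j with hij | hij | hij
    · exact absurd h (aux i j hij j.isLt)
    · exact hij
    · exact absurd h.symm (aux j i hij i.isLt)
  simpa using Nat.card_le_card_of_injective _ hinj

/-- An element of the closure is a product of powers of at most logarithmically many generators. -/
theorem exists_prod_pow {S : Type u} [CommSemigroup S] [Finite S] {X : Set S} {y : S}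
    (hy : y ∈ Subsemigroup.closure X) :
    ∃ (T : Finset S) (a : S → ℕ), (∀ x ∈ T, x ∈ X ∧ 0 < a x) ∧
      ∏ x ∈ T, (x : WithOne S) ^ a x = y ∧ 2 ^ T.card ≤ Nat.card (WithOne S) := by
  classical
  have hex : ∃ k, ∃ (T : Finset S) (a : S → ℕ), T.card = k ∧ (∀ x ∈ T, x ∈ X ∧ 0 < a x) ∧
      ∏ x ∈ T, (x : WithOne S) ^ a x = y := by
    suffices h : ∃ a : S →₀ ℕ, (∀ x ∈ a.support, x ∈ X) ∧
        ∏ x ∈ a.support, (x : WithOne S) ^ a x = y by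
      obtain ⟨a, h1, h2⟩ := h
      exact ⟨_, a.support, a, rfl,
        fun x hx => ⟨h1 x hx, Nat.pos_of_ne_zero (Finsupp.mem_support_iff.1 hx)⟩, h2⟩
    induction hy using Subsemigroup.closure_induction with
    | mem x hx =>
      refine ⟨Finsupp.single x 1, ?_, ?_⟩
      · intro z hz
        rw [Finsupp.mem_support_iff, Finsupp.single_apply_ne_zero] at hz
        exact hz.1 ▸ hx
      · rw [Finsupp.support_single _ one_ne_zero]; simp
    | mul x z _ _ hx hz =>
      obtain ⟨a, ha, ha'⟩ := hx
      obtain ⟨b, hb, hb'⟩ := hz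
      refine ⟨a + b, fun w hw => ?_, ?_⟩
      · rcases Finset.mem_union.1 (Finsupp.support_add hw) with h | h
        exacts [ha w h, hb w h]
      · rw [WithOne.coe_mul, ← ha', ← hb']
        exact Finsupp.prod_add_index' (h := fun (x : S) n => (x : WithOne S) ^ n)
          (fun _ => pow_zero _) (fun _ _ _ => pow_add _ _ _)
  -- `T` has the least possible number of generators; minimality forces all its subproducts to be
  -- distinct, which bounds `2 ^ T.card`.
  obtain ⟨T, a, hk, hT, hprod⟩ := Nat.find_spec hex
  refine ⟨T, a, hT, hprod, ?_⟩
  -- If the products over `I` and `J` agree and `z` lies in `I` but not in `J`, then replacing the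
  -- factors over `I` by those over `J` expresses `y` without `z`. Exponents add up where `J` meets
  -- `T \ I`.
  have aux : ∀ I ⊆ T, ∀ J ⊆ T, ∏ x ∈ I, (x : WithOne S) ^ a x = ∏ x ∈ J, (x : WithOne S) ^ a x →
      I ⊆ J := by
    intro I hI J hJ h
    by_contra hIJ
    obtain ⟨z, hzI, hzJ⟩ := Finset.not_subset.1 hIJ
    let b : S → ℕ := fun x => (if x ∈ J then a x else 0) + (if x ∈ T \ I then a x else 0)
    have hsub : J ∪ (T \ I) ⊆ T := Finset.union_subset hJ Finset.sdiff_subset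
    have hlt : (J ∪ (T \ I)).card < Nat.find hex := by
      rw [← hk]
      refine Finset.card_lt_card (Finset.ssubset_iff_subset_ne.2 ⟨hsub, fun e => ?_⟩)
      have hz : z ∈ J ∪ (T \ I) := by rw [e]; exact hI hzI
      simp [hzI, hzJ] at hz
    refine Nat.find_min hex hlt ⟨J ∪ (T \ I), b, rfl, fun x hx => ⟨(hT x (hsub hx)).1, ?_⟩, ?_⟩
    · have := (hT x (hsub hx)).2
      rcases Finset.mem_union.1 hx with h | h
      · simp only [b, h, if_true]; omega
      · simp only [b, h, if_true]; omega
    · simp only [b, pow_add, Finset.prod_mul_distrib, pow_ite, pow_zero]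
      rw [Finset.prod_ite_mem, Finset.prod_ite_mem,
        Finset.inter_eq_right.2 Finset.subset_union_left,
        Finset.inter_eq_right.2 Finset.subset_union_right, ← h, mul_comm,
        Finset.prod_sdiff hI, hprod]
  have : Finite (WithOne S) := inferInstanceAs (Finite (Option S))
  have hinj : Function.Injective fun I : T.powerset => ∏ x ∈ I.1, (x : WithOne S) ^ a x := by
    rintro ⟨I, hI⟩ ⟨J, hJ⟩ h
    rw [Finset.mem_powerset] at hI hJ
    exact Subtype.ext (Finset.Subset.antisymm (aux I hI J hJ h) (aux J hJ I hI h.symm))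
  rw [← Finset.card_powerset]
  have := Nat.card_le_card_of_injective _ hinj
  rwa [Nat.card_eq_fintype_card, Fintype.card_coe] at this

theorem exists_circuit_of_commSemigroup {S : Type u} [CommSemigroup S] [Finite S] {X : Set S}
    {y : S} (hy : y ∈ Subsemigroup.closure X) :
    ∃ C : CayleyCircuit, C.size ≤ (Nat.log 2 (Nat.card S) + 2) ^ 3 ∧
      ∃ x : C.InputGate → S, (∀ i, x i ∈ X) ∧ C.eval x = y := by
  classical
  obtain ⟨T, a, hT, hprod, hcard⟩ := exists_prod_pow hy
  have : Finite (WithOne S) := inferInstanceAs (Finite (Option S))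
  have : Nonempty S := ⟨y⟩
  have hN : Nat.card (WithOne S) = Nat.card S + 1 := Finite.card_option
  have hpos : 0 < Nat.card S := Nat.card_pos
  set l := Nat.log 2 (Nat.card S) with hl
  have hlog : ∀ m ≤ Nat.card S + 1, Nat.log 2 m ≤ l + 1 := fun m hm =>
    (Nat.log_mono_right (hm.trans (by omega : _ ≤ Nat.card S * 2))).trans
      (Nat.log_mul_base (by omega) hpos.ne').le
  have hTl : T.card ≤ l + 1 := by
    rw [hN] at hcard
    have := hlog _ hcard
    rwa [Nat.log_pow (by omega)] at this
  -- Each generator costs one input, at most `2 * (l + 1)` products for its power, and one product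
  -- to attach it. The value `1` occurs for the empty product, which no program over `S` can
  -- compute.
  have key : ∀ T' ⊆ T, ∃ L, IsProgram X L ∧ L.length ≤ T'.card * (2 * l + 4) ∧
      (∏ x ∈ T', (x : WithOne S) ^ a x = 1 ∨
        ∃ z ∈ L, (z : WithOne S) = ∏ x ∈ T', (x : WithOne S) ^ a x) := by
    intro T'
    induction T' using Finset.induction_on with
    | empty => exact fun _ => ⟨[], .nil, by simp, Or.inl (by simp)⟩
    | insert x T' hx ih =>
      intro hsub
      obtain ⟨L, hL, hlen, hz⟩ := ih ((Finset.subset_insert _ _).trans hsub)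
      obtain ⟨hxX, hax⟩ := hT x (hsub (Finset.mem_insert_self _ _))
      obtain ⟨m, hm, hmN, hme⟩ := exists_pow_eq_pow_le_card (x : WithOne S) hax
      obtain ⟨L', hL', hss, hlen', w, hw, hwe⟩ :=
        (hL.input hxX).exists_pow WithOne.coeMulHom List.mem_cons_self hm
      have hwe' : (w : WithOne S) = (x : WithOne S) ^ a x := hme ▸ hwe
      have hlm := hlog m (hN ▸ hmN)
      rw [Finset.card_insert_of_notMem hx, Finset.prod_insert hx, add_mul, one_mul]
      rw [List.length_cons] at hlen'
      rcases hz with h1 | ⟨z, hz, hze⟩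
      · exact ⟨L', hL', by omega, Or.inr ⟨w, hw, by rw [h1, mul_one, hwe']⟩⟩
      · refine ⟨w * z :: L', hL'.mul hw (hss (List.mem_cons_of_mem _ hz)), ?_, Or.inr
          ⟨_, List.mem_cons_self, by rw [WithOne.coe_mul, hwe', hze]⟩⟩
        rw [List.length_cons]; omega
  obtain ⟨L, hL, hlen, hz⟩ := key T subset_rfl
  rw [hprod] at hz
  rcases hz with h | ⟨z, hz, h⟩
  · exact absurd h WithOne.coe_ne_one
  · rw [WithOne.coe_inj] at h
    obtain ⟨C, hC, h'⟩ := hL.exists_circuit (h ▸ hz)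
    refine ⟨C, hC.trans (hlen.trans ?_), h'⟩
    calc T.card * (2 * l + 4) ≤ (l + 1) * (2 * l + 4) := Nat.mul_le_mul_right _ hTl
      _ ≤ (l + 2) ^ 3 := by nlinarith [Nat.zero_le (l ^ 3), Nat.zero_le (l ^ 2)]

theorem hasPolylogCircuits_comClass : HasPolylogCircuits comClass.{u} :=
  ⟨3, fun S inst _ hS X y hy => by
    let _ : CommSemigroup S := { inst with mul_comm := hS }
    exact exists_circuit_of_commSemigroup hy⟩

/-! ### Groups -/

/-- The reachability lemma of Babai and Szemerédi. -/
theorem exists_program_of_group {G : Type u} [Group G] [Finite G] {X : Set G}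
    {y : G} (hy : y ∈ Subsemigroup.closure X) :
    ∃ L, IsProgram X L ∧ L.length ≤ (Nat.log 2 (Nat.card G) + 2) ^ 4 ∧ y ∈ L := by
  classical
  have hpos : 0 < Nat.card G := Nat.card_pos
  set l := Nat.log 2 (Nat.card G) with hl
  by_contra! hcon
  -- `K` doubles with `i`, while `L` stores what is needed to compute any `k ∈ K` or its inverse
  -- with `i` further products. Allowing every extension `L'` of `L` lets such computations be
  -- chained. A doubling costs at most `4 * l + 5` entries: `2 * i + 1` for `a⁻¹ * b`, one for the
  -- input `x`, one for `g`, and `2 * (l + 1)` for `g⁻¹`.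
  have key : ∀ i, ∃ (K : Finset G) (L : List G), K.card = 2 ^ i ∧ IsProgram X L ∧
      L.length ≤ 1 + 2 * l + i * (4 * l + 5) ∧
      ∀ L', IsProgram X L' → L ⊆ L' → ∀ k ∈ K,
        (∃ L'', IsProgram X L'' ∧ L' ⊆ L'' ∧ L''.length ≤ L'.length + i ∧ k ∈ L'') ∧
        (∃ L'', IsProgram X L'' ∧ L' ⊆ L'' ∧ L''.length ≤ L'.length + i ∧ k⁻¹ ∈ L'') := by
    intro i
    induction i with
    | zero =>
      obtain ⟨x, hx⟩ : X.Nonempty := by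
        rw [Set.nonempty_iff_ne_empty]
        rintro rfl
        rw [Subsemigroup.closure_empty] at hy
        exact hy
      -- The identity is obtained as the power of a generator with exponent the group order.
      obtain ⟨L, hL, -, hlen, z, hz, e⟩ :=
        (IsProgram.nil.input hx).exists_pow (MulHom.id G) List.mem_cons_self hpos
      simp only [MulHom.id_apply, pow_card_eq_one'] at e
      subst e
      refine ⟨{1}, L, by simp, hL, by simpa using hlen, fun L' hL' hss k hk => ?_⟩
      rw [Finset.mem_singleton.1 hk, inv_one]
      exact ⟨⟨L', hL', fun _ => id, le_rfl, hss hz⟩, ⟨L', hL', fun _ => id, le_rfl, hss hz⟩⟩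
    | succ i ih =>
      obtain ⟨K, L, hK, hL, hlen, hreach⟩ := ih
      have hil : i ≤ l := by
        rw [hl, Nat.le_log_iff_pow_le (by omega) hpos.ne', ← hK]
        simpa using Nat.card_le_card_of_injective _ (Subtype.val_injective (p := (· ∈ K)))
      have two : ∀ a ∈ K, ∀ b ∈ K, ∃ L'', IsProgram X L'' ∧ L ⊆ L'' ∧
          L''.length ≤ L.length + (2 * i + 1) ∧ a⁻¹ * b ∈ L'' := by
        intro a ha b hb
        obtain ⟨L1, hL1, hs1, hl1, ha1⟩ := (hreach L hL (fun _ => id) a ha).2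
        obtain ⟨L2, hL2, hs2, hl2, hb2⟩ := (hreach L1 hL1 hs1 b hb).1
        refine ⟨_, hL2.mul (hs2 ha1) hb2, fun z hz => List.mem_cons_of_mem _ (hs2 (hs1 hz)), ?_,
          List.mem_cons_self⟩
        rw [List.length_cons]; omega
      -- If the quotient set `K⁻¹K` is closed under right multiplication by generators, it contains
      -- the whole generated subsemigroup because it contains `1`; then `y` is cheap, against
      -- `hcon`. Otherwise some `g = a⁻¹ * b * x` outside it serves to double `K`.
      by_cases hclosed : ∀ a ∈ K, ∀ b ∈ K, ∀ x ∈ X, ∃ c ∈ K, ∃ d ∈ K, a⁻¹ * b * x = c⁻¹ * d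
      · exfalso
        have hall : ∀ z ∈ Subsemigroup.closure X, ∀ a ∈ K, ∀ b ∈ K,
            ∃ c ∈ K, ∃ d ∈ K, a⁻¹ * b * z = c⁻¹ * d := by
          intro z hz
          induction hz using Subsemigroup.closure_induction with
          | mem x hx => exact fun a ha b hb => hclosed a ha b hb x hx
          | mul z w _ _ h1 h2 =>
            intro a ha b hb
            obtain ⟨c, hc, d, hd, e⟩ := h1 a ha b hb
            rw [← mul_assoc, e]
            exact h2 c hc d hd
        obtain ⟨k, hk⟩ : K.Nonempty := by
          rw [← Finset.card_pos, hK]; positivity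
        obtain ⟨c, hc, d, hd, e⟩ := hall y hy k hk k hk
        rw [inv_mul_cancel, one_mul] at e
        obtain ⟨L', hL', -, hl', hm⟩ := two c hc d hd
        refine hcon L' hL' ?_ (e ▸ hm)
        nlinarith [Nat.zero_le (l ^ 4), Nat.zero_le (l ^ 3), Nat.mul_le_mul_right (4 * l + 5) hil]
      · push Not at hclosed
        obtain ⟨a, ha, b, hb, x, hx, hne⟩ := hclosed
        obtain ⟨L1, hL1, hs1, hl1, hm1⟩ := two a ha b hb
        set g := a⁻¹ * b * x with hg
        have hL2 := (hL1.input hx).mul (List.mem_cons_of_mem _ hm1) List.mem_cons_self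
        rw [← hg] at hL2
        obtain ⟨L3, hL3, hs3, hl3, w, hw, hwe⟩ :=
          -- The exponent is congruent to `-1` modulo the group order; `Nat.card G - 1` would be
          -- zero, hence not allowed, in the trivial group.
          hL2.exists_pow (MulHom.id G) List.mem_cons_self (n := 2 * Nat.card G - 1) (by omega)
        have hwe' : w = g⁻¹ := by
          rw [eq_inv_iff_mul_eq_one]
          change w = g ^ _ at hwe
          rw [hwe, ← pow_succ, Nat.sub_add_cancel (by omega), mul_comm, pow_mul,
            pow_card_eq_one', one_pow]
        subst hwe'
        have hlog : Nat.log 2 (2 * Nat.card G - 1) ≤ l + 1 := by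
          refine (Nat.log_mono_right (Nat.sub_le _ _)).trans ?_
          rw [mul_comm, Nat.log_mul_base (by omega) hpos.ne']
        rw [List.length_cons, List.length_cons] at hl3
        have hgL : g ∈ L3 := hs3 List.mem_cons_self
        have hLL : L ⊆ L3 := fun z hz =>
          hs3 (List.mem_cons_of_mem _ (List.mem_cons_of_mem _ (hs1 hz)))
        -- A coincidence `c = d * g` with `c, d ∈ K` would give `g = d⁻¹ * c`, so the two halves are
        -- disjoint.
        refine ⟨K ∪ K.image (· * g), L3, ?_, hL3, ?_, ?_⟩
        · rw [Finset.card_union_of_disjoint, Finset.card_image_of_injective _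
            (mul_left_injective g), hK]
          · ring
          · rw [Finset.disjoint_left]
            rintro c hc hc'
            obtain ⟨d, hd, rfl⟩ := Finset.mem_image.1 hc'
            exact hne d hd _ hc (by group)
        · nlinarith
        · intro L' hL' hss k hk
          rcases Finset.mem_union.1 hk with hk | hk
          · obtain ⟨⟨A, hA, sA, lA, mA⟩, ⟨B, hB, sB, lB, mB⟩⟩ :=
              hreach L' hL' (fun z hz => hss (hLL hz)) k hk
            exact ⟨⟨A, hA, sA, by omega, mA⟩, ⟨B, hB, sB, by omega, mB⟩⟩
          · obtain ⟨k', hk', rfl⟩ := Finset.mem_image.1 hk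
            obtain ⟨⟨A, hA, sA, lA, mA⟩, ⟨B, hB, sB, lB, mB⟩⟩ :=
              hreach L' hL' (fun z hz => hss (hLL hz)) k' hk'
            refine ⟨⟨_, hA.mul mA (sA (hss hgL)), fun z hz => List.mem_cons_of_mem _ (sA hz), ?_,
              List.mem_cons_self⟩, ⟨_, hB.mul (sB (hss hw)) mB,
              fun z hz => List.mem_cons_of_mem _ (sB hz), ?_, ?_⟩⟩
            · rw [List.length_cons]; omega
            · rw [List.length_cons]; omega
            · rw [mul_inv_rev k' g]; exact List.mem_cons_self
  -- With `l + 1` doublings the set `K` would outgrow the group.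
  obtain ⟨K, -, hK, -⟩ := key (l + 1)
  have h1 : K.card ≤ Nat.card G := by
    simpa using Nat.card_le_card_of_injective _ (Subtype.val_injective (p := (· ∈ K)))
  have h2 := Nat.lt_pow_succ_log_self (b := 2) (by omega) (Nat.card G)
  rw [hK] at h1
  exact absurd h2 (not_lt.2 h1)

theorem hasPolylogCircuits_groupClass : HasPolylogCircuits groupClass.{u} := by
  refine ⟨4, fun S inst _ hS X y hy => ?_⟩
  obtain ⟨G, instG, ⟨e⟩⟩ := hS
  have : Finite G := Finite.of_equiv S e.toEquiv
  have hy' : e y ∈ Subsemigroup.closure (e '' X) := by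
    have := Subsemigroup.mem_map_of_mem (e : S →ₙ* G) hy
    rwa [MulHom.map_mclosure] at this
  obtain ⟨L, hL, hl, hm⟩ := exists_program_of_group hy'
  have hL' := hL.map (e.symm : G →ₙ* S) (Y := X) (by
    rintro _ ⟨x, hx, rfl⟩
    simpa using hx)
  have hym : y ∈ L.map (e.symm : G →ₙ* S) := List.mem_map.2 ⟨_, hm, by simp⟩
  obtain ⟨C, hC, h⟩ := hL'.exists_circuit hym
  refine ⟨C, hC.trans ?_, h⟩
  rwa [List.length_map, Nat.card_congr e.toEquiv]

/-! ### Construction of Boolean circuits -/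

namespace Gate

variable {W W' : Type}

/-- The wires that come into a gate. -/
def wires : Gate W → Set W
  | not w => {w}
  | and s => s
  | or s => s
  | mod _ s => s
  | maj s => s

/-- Renaming of wires. -/
def map (e : W ↪ W') : Gate W → Gate W'
  | not w => not (e w)
  | and s => and (s.map e)
  | or s => or (s.map e)
  | mod m s => mod m (s.map e)
  | maj s => maj (s.map e)

theorem eval_map (e : W ↪ W') (v : W' → Bool) (g : Gate W) :
    (g.map e).eval v = g.eval (v ∘ e) := by
  cases g <;> simp [map, eval, Finset.filter_map]

theorem depth_map (e : W ↪ W') (d : W' → ℕ) (g : Gate W) :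
    (g.map e).depth d = g.depth (d ∘ e) := by
  cases g <;> simp [map, depth]

theorem isACC_map (e : W ↪ W') (m : ℕ) (g : Gate W) : (g.map e).IsACC m ↔ g.IsACC m := by
  cases g <;> rfl

theorem isTC_map (e : W ↪ W') (g : Gate W) : (g.map e).IsTC ↔ g.IsTC := by
  cases g <;> rfl

theorem isNC_map (e : W ↪ W') (g : Gate W) : (g.map e).IsNC ↔ g.IsNC := by
  cases g <;> simp [map, IsNC]

/-- This is what turns a gate over all indices into a gate over the earlier ones, once its wires are
known to come from there. -/
theorem exists_map_eq (e : W ↪ W') (g : Gate W') (h : ∀ w ∈ g.wires, w ∈ Set.range e) :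
    ∃ g' : Gate W, g'.map e = g := by
  have key : ∀ s : Finset W', (∀ w ∈ s, w ∈ Set.range e) → ∃ t : Finset W, t.map e = s := by
    intro s hs
    refine ⟨s.preimage e e.injective.injOn, ?_⟩
    ext w
    simp only [Finset.mem_map, Finset.mem_preimage]
    constructor
    · rintro ⟨a, ha, rfl⟩
      exact ha
    · intro hw
      obtain ⟨a, rfl⟩ := hs w hw
      exact ⟨a, hw, rfl⟩
  cases g with
  | not w =>
    obtain ⟨a, ha⟩ := h w rfl
    exact ⟨not a, by rw [map, ha]⟩
  | and s => exact (key s h).elim fun t ht => ⟨and t, by rw [map, ht]⟩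
  | or s => exact (key s h).elim fun t ht => ⟨or t, by rw [map, ht]⟩
  | mod m s => exact (key s h).elim fun t ht => ⟨mod m t, by rw [map, ht]⟩
  | maj s => exact (key s h).elim fun t ht => ⟨maj t, by rw [map, ht]⟩

theorem depth_mono {d d' : W → ℕ} (h : ∀ w, d w ≤ d' w) (g : Gate W) : g.depth d ≤ g.depth d' := by
  cases g <;> simp only [depth] <;>
    first | exact h _ | exact Nat.succ_le_succ (Finset.sup_mono_fun fun w _ => h w)

theorem cost_le_one (g : Gate W) : g.cost ≤ 1 := by
  cases g <;> simp [cost]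

end Gate

/-- A finite family of gates, in which the wires into a gate come from gates of smaller rank,
can be arranged as a circuit. -/
theorem exists_circuit_of_rank {n : ℕ} {ι : Type} [Fintype ι] (r : ι → ℕ)
    (gate : ι → Gate (Fin n ⊕ ι)) (hr : ∀ a b, Sum.inr b ∈ (gate a).wires → r b < r a)
    (val : (Fin n → Bool) → ι → Bool)
    (hval : ∀ x a, (gate a).eval (Sum.elim x (val x)) = val x a)
    (dep : ι → ℕ) (hdep : ∀ a, (gate a).depth (Sum.elim (fun _ => 0) dep) ≤ dep a)
    {D : ℕ} (hD : ∀ a, dep a ≤ D) (out : ι) :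
    ∃ C : Circuit n 1, (∀ x, C.eval x 0 = val x out) ∧ C.depth ≤ D ∧
      C.size ≤ Fintype.card ι ∧
      ∀ i : Fin C.numGates, ∃ a, ∃ e : Fin n ⊕ Fin i ↪ Fin n ⊕ ι, (C.gate i).map e = gate a := by
  classical
  let f := (Fintype.equivFin ι).symm
  -- Sorting by rank is a topological order; the order within a rank is irrelevant because ranks
  -- drop strictly along wires.
  let e : Fin (Fintype.card ι) ≃ ι := (Tuple.sort (r ∘ f)).trans f
  have hmono : Monotone (r ∘ e) := Tuple.monotone_sort (r ∘ f)
  have hlt : ∀ i j, r (e i) < r (e j) → i < j := fun i j h => by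
    by_contra hij
    exact absurd (hmono (not_lt.1 hij)) (not_le.2 h)
  let emb : ∀ i : Fin (Fintype.card ι), Fin i.val ↪ ι := fun i =>
    (Fin.castLEEmb i.isLt.le).trans e.toEmbedding
  let E : ∀ i : Fin (Fintype.card ι), Fin n ⊕ Fin i.val ↪ Fin n ⊕ ι := fun i =>
    (Function.Embedding.refl _).sumMap (emb i)
  have hg : ∀ i : Fin (Fintype.card ι), ∃ g : Gate (Fin n ⊕ Fin i.val),
      g.map (E i) = gate (e i) := by
    intro i
    refine Gate.exists_map_eq _ _ fun w hw => ?_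
    rcases w with j | b
    · exact ⟨Sum.inl j, rfl⟩
    · have h := hr _ _ hw
      obtain ⟨k, rfl⟩ := e.surjective b
      exact ⟨Sum.inr ⟨k, hlt _ _ h⟩, rfl⟩
  choose g hg using hg
  let C : Circuit n 1 := ⟨_, g, fun _ => Sum.inr (e.symm out)⟩
  have hgv : ∀ x m, ∀ i : Fin C.numGates, i.val = m → C.gateVal x i = val x (e i) := by
    intro x m
    induction m using Nat.strong_induction_on with
    | _ m ih =>
      intro i hi
      rw [Circuit.gateVal, ← hval, ← hg, Gate.eval_map]
      congr 1
      funext w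
      rcases w with j | p
      · rfl
      · exact ih p.val (hi ▸ p.isLt) ⟨p, p.isLt.trans i.isLt⟩ rfl
  have hgd : ∀ m, ∀ i : Fin C.numGates, i.val = m → C.gateDepth i ≤ dep (e i) := by
    intro m
    induction m using Nat.strong_induction_on with
    | _ m ih =>
      intro i hi
      rw [Circuit.gateDepth]
      refine le_trans ?_ (hdep (e i))
      rw [← hg, Gate.depth_map]
      refine Gate.depth_mono (fun w => ?_) _
      rcases w with j | p
      · exact le_rfl
      · exact ih p.val (hi ▸ p.isLt) ⟨p, p.isLt.trans i.isLt⟩ rfl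
  refine ⟨C, fun x => ?_, ?_, ?_, fun i => ⟨e i, E i, hg i⟩⟩
  · change C.gateVal x (e.symm out) = _
    rw [hgv x _ _ rfl, e.apply_symm_apply]
  · exact Finset.sup_le fun i _ => (hgd _ i rfl).trans (hD _)
  · refine (Finset.sum_le_card_nsmul _ _ 1 fun i _ => Gate.cost_le_one _).trans ?_
    simp [C]

/-! ### Circuits for parity -/

theorem count_true_eq_card (w : List Bool) :
    w.count true = (Finset.univ.filter fun j => w.get j = true).card := by
  induction w with
  | nil => rfl
  | cons b w ih =>
    rw [List.count_cons, ih, Finset.card_filter, Finset.card_filter]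
    change _ = ∑ i : Fin (w.length + 1), _
    rw [Fin.sum_univ_succ, add_comm]
    cases b <;> simp

theorem decides_parity {C : (n : ℕ) → Circuit n 1}
    (h : ∀ n x, (C n).eval x 0 = decide (Odd (Finset.univ.filter fun j => x j = true).card)) :
    Decides C Parity := by
  intro w
  rw [h, decide_eq_true_iff, ← count_true_eq_card]
  rfl

/-- A MOD-2 gate recognises an even number of ones, so its negation is parity; the NOT gate does not
add to the depth. -/
theorem parity_mem_ACC0 : Parity ∈ ACC0 := by
  have key : ∀ n, ∃ C : Circuit n 1,
      (∀ x, C.eval x 0 = decide (Odd (Finset.univ.filter fun j => x j = true).card)) ∧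
      (∀ i, (C.gate i).IsACC 2) ∧ C.depth ≤ 1 ∧ C.size ≤ 2 := by
    intro n
    let gate : Bool → Gate (Fin n ⊕ Bool)
      | false => .mod 2 (Finset.univ.map Function.Embedding.inl)
      | true => .not (Sum.inr false)
    let val : (Fin n → Bool) → Bool → Bool := fun x a =>
      a.xor (decide (2 ∣ (Finset.univ.filter fun j => x j = true).card))
    obtain ⟨C, h1, h2, h3, h4⟩ := exists_circuit_of_rank (fun a : Bool => a.toNat) gate
      (by rintro (_ | _) (_ | _) <;> simp [gate, Gate.wires]) val
      (by
        rintro x (_ | _)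
        · simp [gate, val, Gate.eval, Finset.filter_map]
        · simp [gate, val, Gate.eval]) (fun _ => 1)
      (by
        rintro (_ | _)
        · simp [gate, Gate.depth, Function.comp_def]
        · simp [gate, Gate.depth]) (D := 1) (fun _ => le_rfl) true
    refine ⟨C, fun x => ?_, fun i => ?_, h2, h3⟩
    · rw [h1]
      simp only [val, Bool.true_xor, ← even_iff_two_dvd, ← Nat.not_even_iff_odd, decide_not]
    · obtain ⟨a, e, he⟩ := h4 i
      rw [← Gate.isACC_map e, he]
      cases a
      exacts [rfl, trivial]
  choose C h1 h2 h3 h4 using key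
  exact ⟨C, 2, 1, 2, le_rfl, decides_parity h1, fun n => ⟨h2 n, h3 n, (h4 n).trans (by omega)⟩⟩

/-- Majority gates and constants give all threshold functions. -/
theorem threshold_iff {n k c : ℕ} :
    n + (n - 2 * k) + (2 * k - n) ≤ 2 * (c + (n - 2 * k)) ↔ k ≤ c := by omega

/-- The gates of the threshold circuit for parity; the first component of the index of a gate is its
kind: constant ones, constant zeros, thresholds, their negations, exact counts, and the
output. -/
def thresholdGate (n : ℕ) : Fin 6 × Fin (n + 2) → Gate (Fin n ⊕ (Fin 6 × Fin (n + 2)))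
  | (0, _) => .and ∅
  | (1, _) => .or ∅
  | (2, k) => .maj (Finset.univ.disjSum
      ((({0} : Finset (Fin 6)) ×ˢ Finset.univ.filter fun j => j.val < n - 2 * k.val) ∪
        (({1} : Finset (Fin 6)) ×ˢ Finset.univ.filter fun j => j.val < 2 * k.val - n)))
  | (3, k) => .not (Sum.inr (2, k))
  | (4, k) => .and {Sum.inr (2, k), Sum.inr (3, k + 1)}
  | (5, _) => .or ((({4} : Finset (Fin 6)) ×ˢ
      Finset.univ.filter fun k : Fin (n + 2) => Odd k.val).map Function.Embedding.inr)

/-- The values of the gates of the threshold circuit on an input with `c` ones. -/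
def thresholdVal (n c : ℕ) : Fin 6 × Fin (n + 2) → Bool
  | (0, _) => true
  | (1, _) => false
  | (2, k) => decide (k.val ≤ c)
  | (3, k) => !decide (k.val ≤ c)
  | (4, k) => decide (k.val ≤ c) && !decide ((k + 1).val ≤ c)
  | (5, _) => decide (Odd c)

/-- Padding the input with `n - 2 * k` ones and `2 * k - n` zeros (truncated, so at most one is
nonzero) moves the majority threshold to `k`. The input has exactly `k` ones if threshold `k` holds
and threshold `k + 1` fails, and parity is the disjunction of these tests over odd `k`. -/
theorem thresholdGate_eval (n : ℕ) (x : Fin n → Bool) (a : Fin 6 × Fin (n + 2)) :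
    (thresholdGate n a).eval (Sum.elim x
      (thresholdVal n (Finset.univ.filter fun j => x j = true).card)) =
      thresholdVal n (Finset.univ.filter fun j => x j = true).card a := by
  have hc : (Finset.univ.filter fun j => x j = true).card ≤ n := by
    simpa using Finset.card_le_univ (Finset.univ.filter fun j => x j = true)
  obtain ⟨a, k⟩ := a
  fin_cases a
  · simp [thresholdGate, thresholdVal, Gate.eval]
  · simp [thresholdGate, thresholdVal, Gate.eval]
  · set c := (Finset.univ.filter fun j => x j = true).card with hcd
    set A := ({0} : Finset (Fin 6)) ×ˢ
      Finset.univ.filter fun j : Fin (n + 2) => j.val < n - 2 * k.val with hA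
    set B := ({1} : Finset (Fin 6)) ×ˢ
      Finset.univ.filter fun j : Fin (n + 2) => j.val < 2 * k.val - n with hB
    have hAB : Disjoint A B := by
      rw [Finset.disjoint_left]
      rintro ⟨p, q⟩ hp hq
      simp only [hA, hB, Finset.mem_product, Finset.mem_singleton] at hp hq
      exact absurd (hp.1.symm.trans hq.1) (by decide)
    have hAc : A.card = n - 2 * k.val := by
      rw [hA, Finset.card_product, Finset.card_singleton, one_mul, Fin.card_filter_val_lt]
      omega
    have hBc : B.card = 2 * k.val - n := by
      have := k.isLt
      rw [hB, Finset.card_product, Finset.card_singleton, one_mul, Fin.card_filter_val_lt]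
      omega
    have hs : (Finset.univ.disjSum (A ∪ B) : Finset (Fin n ⊕ _)).filter
        (fun w => Sum.elim x (thresholdVal n c) w = true) =
        (Finset.univ.filter fun j => x j = true).disjSum A := by
      ext w
      rcases w with j | ⟨p, q⟩
      · simp
      · simp only [Finset.mem_filter, Finset.inr_mem_disjSum, Finset.mem_union, Sum.elim_inr, hA,
          hB, Finset.mem_product, Finset.mem_singleton, Finset.mem_univ, true_and]
        constructor
        · rintro ⟨h | ⟨rfl, h⟩, h'⟩
          · exact h
          · exact absurd h' (by simp [thresholdVal])
        · rintro ⟨rfl, h⟩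
          exact ⟨Or.inl ⟨rfl, h⟩, rfl⟩
    change Gate.eval _ (Gate.maj (Finset.univ.disjSum (A ∪ B))) = decide (k.val ≤ c)
    rw [Gate.eval, hs, Finset.card_disjSum, Finset.card_disjSum, Finset.card_union_of_disjoint hAB,
      hAc, hBc, Finset.card_univ, Fintype.card_fin, ← hcd, ← add_assoc]
    exact decide_eq_decide.2 threshold_iff
  · simp [thresholdGate, thresholdVal, Gate.eval]
  · simp [thresholdGate, thresholdVal, Gate.eval]
    simp only [← not_le, decide_not]
  · set c := (Finset.univ.filter fun j => x j = true).card
    change Gate.eval _ (Gate.or _) = decide (Odd c)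
    rw [Gate.eval, decide_eq_decide]
    simp only [Finset.mem_map, Finset.mem_product, Finset.mem_singleton, Finset.mem_filter,
      Finset.mem_univ, true_and, Function.Embedding.inr_apply]
    -- Addition in `Fin (n + 2)` wraps only at `k = n + 1`, where threshold `k` already fails.
    have hsucc : ∀ k : Fin (n + 2), k.val ≤ n → (k + 1).val = k.val + 1 := fun k hk => by
      rw [Fin.val_add_one_of_lt]
      rw [Fin.lt_def, Fin.val_last]
      omega
    constructor
    · rintro ⟨_, ⟨⟨p, k⟩, ⟨hp, hk⟩, rfl⟩, h⟩
      dsimp only at hp hk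
      subst hp
      have h : (decide (k.val ≤ c) && !decide ((k + 1).val ≤ c)) = true := h
      simp only [Bool.and_eq_true, decide_eq_true_iff, Bool.not_eq_true', decide_eq_false_iff_not]
        at h
      rw [hsucc k (h.1.trans hc)] at h
      rwa [show c = k.val by omega]
    · intro ho
      refine ⟨_, ⟨(4, ⟨c, by omega⟩), ⟨rfl, ho⟩, rfl⟩, ?_⟩
      change (decide (c ≤ c) && !decide _) = true
      rw [hsucc _ hc]
      simp

theorem parity_mem_TC0 : Parity ∈ TC0 := by
  have key : ∀ n, ∃ C : Circuit n 1,
      (∀ x, C.eval x 0 = decide (Odd (Finset.univ.filter fun j => x j = true).card)) ∧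
      (∀ i, (C.gate i).IsTC) ∧ C.depth ≤ 6 ∧ C.size ≤ 6 * (n + 2) := by
    intro n
    obtain ⟨C, h1, h2, h3, h4⟩ := exists_circuit_of_rank (fun a => a.1.val) (thresholdGate n)
      (by
        rintro ⟨a, k⟩ ⟨b, j⟩
        fin_cases a
        · simp [thresholdGate, Gate.wires]
        · simp [thresholdGate, Gate.wires]
        · simp only [thresholdGate, Gate.wires]
          simp
          rintro (⟨-, rfl⟩ | ⟨-, rfl⟩) <;> decide
        · simp [thresholdGate, Gate.wires]
          rintro rfl -
          decide
        · simp [thresholdGate, Gate.wires]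
          rintro (⟨rfl, -⟩ | ⟨rfl, -⟩) <;> decide
        · simp [thresholdGate, Gate.wires]
          rintro - rfl
          decide)
      (fun x => thresholdVal n (Finset.univ.filter fun j => x j = true).card)
      (thresholdGate_eval n) (fun a => a.1.val + 1)
      (by
        rintro ⟨a, k⟩
        fin_cases a
        · simp [thresholdGate, Gate.depth]
        · simp [thresholdGate, Gate.depth]
        · simp only [thresholdGate, Gate.depth]
          refine Nat.succ_le_succ (Finset.sup_le fun w hw => ?_)
          rcases w with j | ⟨p, q⟩
          · simp
          · simp at hw
            rcases hw with ⟨-, rfl⟩ | ⟨-, rfl⟩ <;> simp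
        · simp [thresholdGate, Gate.depth]
        · simp [thresholdGate, Gate.depth]
        · simp only [thresholdGate, Gate.depth]
          refine Nat.succ_le_succ (Finset.sup_le fun w hw => ?_)
          rcases w with j | ⟨p, q⟩
          · simp
          · simp at hw
            rcases hw with ⟨-, rfl⟩
            simp)
      (D := 6) (fun a => a.1.isLt) (5, 0)
    refine ⟨C, h1, fun i => ?_, h2, by simpa using h3⟩
    obtain ⟨⟨a, k⟩, e, he⟩ := h4 i
    rw [← Gate.isTC_map e, he]
    fin_cases a <;> trivial
  choose C h1 h2 h3 h4 using key
  -- The number 18 is exponent and additive constant at once; the additive part covers `n = 0` and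
  -- `n = 1`, where `6 * (n + 2)` is 12 and 18.
  refine ⟨C, 6, 18, decides_parity h1, fun n => ⟨h2 n, h3 n, (h4 n).trans ?_⟩⟩
  rcases n with _ | _ | n
  · simp
  · simp
  · have h : (n + 2) ^ 3 ≤ (n + 2) ^ 18 := Nat.pow_le_pow_right (by omega) (by omega)
    change 6 * (n + 2 + 2) ≤ (n + 2) ^ 18 + 18
    nlinarith [Nat.zero_le (n ^ 3), Nat.zero_le (n ^ 2)]

/-! ### Parity by a balanced tree -/

/-- The input bits, as a function on `ℤ/M`. -/
def paddedInput {n M : ℕ} (x : Fin n → Bool) (p : ZMod M) : Bool :=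
  if h : p.val < n then x ⟨p.val, h⟩ else false

/-- The sum modulo two of `2 ^ l` consecutive bits from position `p`. -/
def blockParity {n M : ℕ} (x : Fin n → Bool) : ℕ → ZMod M → Bool
  | 0, p => paddedInput x p
  | l + 1, p => xor (blockParity x l p) (blockParity x l (p + 2 ^ l))

/-- Exclusive or is addition modulo two, and a block splits into two halves. With positions taken
cyclically, `p + 2 ^ l` needs no boundary case. -/
theorem blockParity_eq_sum {n M : ℕ} (x : Fin n → Bool) (l : ℕ) (p : ZMod M) :
    (((blockParity x l p).toNat : ℕ) : ZMod 2) =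
      ∑ i ∈ Finset.range (2 ^ l), ((paddedInput x (p + (i : ZMod M))).toNat : ZMod 2) := by
  induction l generalizing p with
  | zero => simp [blockParity]
  | succ l ih =>
    have hx : ∀ a b : Bool, (((xor a b).toNat : ℕ) : ZMod 2) = (a.toNat : ZMod 2) + b.toNat := by
      decide
    rw [blockParity, hx, ih, ih, pow_succ, mul_two, Finset.sum_range_add]
    simp [add_assoc]

/-- The block of full length from position zero meets every position once, and the padding
contributes zeros. -/
theorem blockParity_top {n h : ℕ} (hn : n ≤ 2 ^ h) (x : Fin n → Bool) :
    blockParity x h (0 : ZMod (2 ^ h)) =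
      decide (Odd (Finset.univ.filter fun j => x j = true).card) := by
  have hsum : ∑ i ∈ Finset.range (2 ^ h), ((paddedInput x ((i : ℕ) : ZMod (2 ^ h))).toNat : ℕ) =
      (Finset.univ.filter fun j => x j = true).card := by
    have hval : ∀ i ∈ Finset.range (2 ^ h), (paddedInput x ((i : ℕ) : ZMod (2 ^ h))).toNat =
        if hi : i < n then (x ⟨i, hi⟩).toNat else 0 := fun i hi => by
      simp only [paddedInput, ZMod.val_natCast, Nat.mod_eq_of_lt (Finset.mem_range.1 hi)]
      split <;> rfl
    rw [Finset.sum_congr rfl hval, Finset.card_filter,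
      ← Finset.sum_subset (Finset.range_subset_range.2 hn), Finset.sum_range]
    · refine Finset.sum_congr rfl fun j _ => ?_
      simp only [j.isLt, dite_true]
      cases x j <;> rfl
    · intro i _ hi
      rw [Finset.mem_range] at hi
      simp [hi]
  have h1 := blockParity_eq_sum x h (0 : ZMod (2 ^ h))
  simp only [zero_add] at h1
  rw [← Nat.cast_sum, hsum, ZMod.natCast_eq_natCast_iff'] at h1
  simp only [Nat.odd_iff, ← h1]
  cases blockParity x h (0 : ZMod (2 ^ h)) <;> simp

/-- The indices of the gates of the balanced tree: the bits of level zero, and for each level `l` the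
disjunctions, the conjunctions and their negations of two bits of level `l`, and the bits of
level `l + 1`. -/
abbrev TreeIndex (h : ℕ) : Type :=
  ZMod (2 ^ h) ⊕ (Fin h × ZMod (2 ^ h) ⊕ Fin h × ZMod (2 ^ h)) ⊕
    (Fin h × ZMod (2 ^ h) ⊕ Fin h × ZMod (2 ^ h))

instance (h : ℕ) : DecidableEq (TreeIndex h) := inferInstance

/-- The index of a bit of level `l`. -/
def treeBit {h : ℕ} (p : ZMod (2 ^ h)) : (l : ℕ) → l ≤ h → TreeIndex h
  | 0, _ => .inl p
  | l + 1, hl => .inr (.inr (.inr (⟨l, hl⟩, p)))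

/-- The two bits of level `l` from which a bit of level `l + 1` is computed. -/
def treeChildren (n : ℕ) {h : ℕ} (a : Fin h × ZMod (2 ^ h)) : Finset (Fin n ⊕ TreeIndex h) :=
  {Sum.inr (treeBit a.2 a.1 a.1.isLt.le), Sum.inr (treeBit (a.2 + 2 ^ a.1.val) a.1 a.1.isLt.le)}

/-- The gates of the balanced tree. -/
def treeGate (n h : ℕ) : TreeIndex h → Gate (Fin n ⊕ TreeIndex h)
  | .inl p => .or (if hp : p.val < n then {Sum.inl ⟨p.val, hp⟩} else ∅)
  | .inr (.inl (.inl a)) => .or (treeChildren n a)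
  | .inr (.inl (.inr a)) => .and (treeChildren n a)
  | .inr (.inr (.inl a)) => .not (.inr (.inr (.inl (.inr a))))
  | .inr (.inr (.inr a)) => .and {Sum.inr (.inr (.inl (.inl a))), Sum.inr (.inr (.inr (.inl a)))}

/-- The values of the gates of the balanced tree. -/
def treeVal {n h : ℕ} (x : Fin n → Bool) : TreeIndex h → Bool
  | .inl p => paddedInput x p
  | .inr (.inl (.inl (l, p))) => blockParity x l p || blockParity x l (p + 2 ^ l.val)
  | .inr (.inl (.inr (l, p))) => blockParity x l p && blockParity x l (p + 2 ^ l.val)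
  | .inr (.inr (.inl (l, p))) => !(blockParity x l p && blockParity x l (p + 2 ^ l.val))
  | .inr (.inr (.inr (l, p))) => blockParity x (l + 1) p

theorem treeVal_treeBit {n h : ℕ} (x : Fin n → Bool) (p : ZMod (2 ^ h)) (l : ℕ) (hl : l ≤ h) :
    treeVal x (treeBit p l hl) = blockParity x l p := by
  cases l <;> rfl

/-- Exclusive or is computed as `(a ∨ b) ∧ ¬(a ∧ b)`. This takes three ranks per level but only two
units of depth, as negations are free. -/
theorem treeGate_eval {n h : ℕ} (x : Fin n → Bool) (a : TreeIndex h) :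
    (treeGate n h a).eval (Sum.elim x (treeVal x)) = treeVal x a := by
  rcases a with p | (⟨l, p⟩ | ⟨l, p⟩) | (⟨l, p⟩ | ⟨l, p⟩)
  · by_cases hp : p.val < n <;> simp [treeGate, treeVal, Gate.eval, paddedInput, hp]
  · simp [treeGate, treeChildren, Gate.eval, treeVal_treeBit]
    rfl
  · simp [treeGate, treeChildren, Gate.eval, treeVal_treeBit]
    rfl
  · rfl
  · simp [treeGate, Gate.eval, treeVal, blockParity]
    cases blockParity x l p <;> cases blockParity x l (p + 2 ^ l.val) <;> rfl

/-- A rank function for the gates of the balanced tree. -/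
def treeRank {h : ℕ} : TreeIndex h → ℕ
  | .inl _ => 0
  | .inr (.inl (.inl (l, _))) => 3 * l + 1
  | .inr (.inl (.inr (l, _))) => 3 * l + 1
  | .inr (.inr (.inl (l, _))) => 3 * l + 2
  | .inr (.inr (.inr (l, _))) => 3 * l + 3

theorem treeRank_treeBit {h : ℕ} (p : ZMod (2 ^ h)) (l : ℕ) (hl : l ≤ h) :
    treeRank (treeBit p l hl) = 3 * l := by
  cases l <;> rfl

/-- A bound for the depths of the gates of the balanced tree. -/
def treeDepth {h : ℕ} : TreeIndex h → ℕ
  | .inl _ => 1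
  | .inr (.inl (.inl (l, _))) => 2 * l + 2
  | .inr (.inl (.inr (l, _))) => 2 * l + 2
  | .inr (.inr (.inl (l, _))) => 2 * l + 2
  | .inr (.inr (.inr (l, _))) => 2 * l + 3

theorem treeDepth_treeBit {h : ℕ} (p : ZMod (2 ^ h)) (l : ℕ) (hl : l ≤ h) :
    treeDepth (treeBit p l hl) = 2 * l + 1 := by
  cases l <;> rfl

theorem treeGate_rank {n h : ℕ} (a b : TreeIndex h) (hb : Sum.inr b ∈ (treeGate n h a).wires) :
    treeRank b < treeRank a := by
  have hch : ∀ a : Fin h × ZMod (2 ^ h), Sum.inr b ∈ treeChildren n a →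
      treeRank b < 3 * a.1.val + 1 := by
    intro a ha
    rw [treeChildren, Finset.mem_insert, Finset.mem_singleton, Sum.inr.injEq, Sum.inr.injEq] at ha
    rcases ha with rfl | rfl <;> rw [treeRank_treeBit] <;> omega
  rcases a with p | (a | a) | (a | a)
  · by_cases hp : p.val < n <;> simp [treeGate, Gate.wires, hp] at hb
  · exact hch a hb
  · exact hch a hb
  · obtain rfl : b = .inr (.inl (.inr a)) := Sum.inr_injective hb
    exact Nat.lt_succ_self _
  · simp [treeGate, Gate.wires] at hb
    rcases hb with rfl | rfl <;> simp [treeRank]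

theorem treeGate_depth {n h : ℕ} (a : TreeIndex h) :
    (treeGate n h a).depth (Sum.elim (fun _ => 0) treeDepth) ≤ treeDepth a := by
  rcases a with p | (a | a) | (a | a)
  · by_cases hp : p.val < n <;> simp [treeGate, Gate.depth, treeDepth, hp]
  · simp [treeGate, Gate.depth, treeChildren, treeDepth_treeBit]
    exact Nat.lt_succ_self _
  · simp [treeGate, Gate.depth, treeChildren, treeDepth_treeBit]
    exact Nat.lt_succ_self _
  · simp [treeGate, Gate.depth, treeDepth]
  · simp [treeGate, Gate.depth, treeDepth]

theorem parity_mem_NC1 : Parity ∈ NC1 := by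
  have key : ∀ n, ∃ C : Circuit n 1,
      (∀ x, C.eval x 0 = decide (Odd (Finset.univ.filter fun j => x j = true).card)) ∧
      (∀ i, (C.gate i).IsNC) ∧ C.depth ≤ 2 * Nat.clog 2 n + 1 ∧
      C.size ≤ 4 * (Nat.clog 2 n + 1) * 2 ^ Nat.clog 2 n := by
    intro n
    set h := Nat.clog 2 n
    obtain ⟨C, h1, h2, h3, h4⟩ := exists_circuit_of_rank treeRank (treeGate n h) treeGate_rank
      treeVal treeGate_eval treeDepth treeGate_depth (D := 2 * h + 1)
      (by
        rintro (p | (⟨l, p⟩ | ⟨l, p⟩) | (⟨l, p⟩ | ⟨l, p⟩)) <;> simp only [treeDepth] <;> omega)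
      (treeBit 0 h le_rfl)
    refine ⟨C, fun x => (h1 x).trans ?_, fun i => ?_, h2, h3.trans ?_⟩
    · rw [treeVal_treeBit]
      exact blockParity_top (Nat.le_pow_clog (by omega) n) x
    · obtain ⟨a, e, he⟩ := h4 i
      rw [← Gate.isNC_map e, he]
      rcases a with p | (a | a) | (a | a)
      · by_cases hp : p.val < n <;> simp [treeGate, Gate.IsNC, hp]
      · exact Finset.card_le_two
      · exact Finset.card_le_two
      · trivial
      · exact Finset.card_le_two
    · simp only [Fintype.card_sum, Fintype.card_prod, Fintype.card_fin, ZMod.card]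
      nlinarith [Nat.zero_le (2 ^ h)]
  choose C h1 h2 h3 h4 using key
  have hlog : ∀ n, Nat.clog 2 n ≤ Nat.log 2 n + 1 := fun n =>
    Nat.clog_le_of_le_pow (Nat.lt_pow_succ_log_self (by omega) n).le
  refine ⟨C, 4, 16, decides_parity h1, fun n => ⟨h2 n, (h3 n).trans ?_, (h4 n).trans ?_⟩⟩
  · have := hlog n
    omega
  -- The estimate `2 ^ Nat.clog 2 n ≤ 2 * n` fails for `n = 0`.
  · rcases Nat.eq_zero_or_pos n with rfl | hn
    · simp
    · have e1 : 2 ^ Nat.clog 2 n ≤ 2 * n := by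
        refine (Nat.pow_le_pow_right (by omega) (hlog n)).trans ?_
        rw [pow_succ, mul_comm]
        exact Nat.mul_le_mul_left _ (Nat.pow_log_le_self 2 hn.ne')
      have e2 : Nat.clog 2 n + 1 ≤ 2 * n := (Nat.lt_two_pow_self).trans_le e1
      calc 4 * (Nat.clog 2 n + 1) * 2 ^ Nat.clog 2 n ≤ 4 * (2 * n) * (2 * n) := by gcongr
        _ = 16 * n ^ 2 := by ring
        _ ≤ n ^ 16 + 16 := by
          rcases Nat.lt_or_ge n 2 with h | h
          · interval_cases n; simp
          · have : n ^ 16 = n ^ 14 * n ^ 2 := by ring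
            have h' : 2 ^ 14 ≤ n ^ 14 := Nat.pow_le_pow_left h 14
            nlinarith [Nat.zero_le (n ^ 2)]

/-! ### A logarithmic space machine for parity -/

/-- The machine that computes the parity of its input while moving its input head to the right. The
state `some b` records the parity of the bits read so far, the state `none` accepts. -/
def parityMachine : Machine where
  State := Option Bool
  Symbol := Unit
  finite_state := inferInstance
  finite_symbol := inferInstance
  start := some false
  accepting := {none}
  blank := ()
  δ
    | some b, .left, _ => {(some b, (), .right, .stay)}
    | some b, .bit c, _ => {(some (xor b c), (), .right, .stay)}
    | some true, .right, _ => {(none, (), .stay, .stay)}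
    | _, _, _ => ∅

theorem parityMachine_isDeterministic : parityMachine.IsDeterministic := by
  rintro (_ | _ | _) (_ | _ | _) s <;> simp [parityMachine]

theorem decide_odd_count_take_succ {w : List Bool} {p : ℕ} (hp : p < w.length) :
    decide (Odd ((w.take (p + 1)).count true)) =
      xor (decide (Odd ((w.take p).count true))) w[p] := by
  rw [List.take_succ_eq_append_getElem hp, List.count_append]
  cases w[p] <;> simp [Nat.odd_add_one, -Nat.not_odd_iff_even]

/-- The configurations that occur in a computation of `parityMachine`. -/
def ParityInvariant (w : List Bool) (c : parityMachine.Config) : Prop :=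
  c.workHead = 0 ∧ c.inputHead ≤ w.length + 1 ∧
    (c.state = some (decide (Odd ((w.take (c.inputHead - 1)).count true))) ∨
      c.state = none ∧ Odd (w.count true))

/-- Each step advances the input head or enters the accepting state, which has no successor; this
yields correctness and termination together. With the head on cell `p`, exactly `p - 1` bits have
been read, truncation taking care of the left end marker. -/
theorem parityMachine_step {w : List Bool} {c c' : parityMachine.Config}
    (hc : ParityInvariant w c) (h : parityMachine.Step w c c') :
    ParityInvariant w c' ∧ (c'.inputHead = c.inputHead + 1 ∨ c'.state = none) ∧
      c.state ≠ none := by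
  obtain ⟨hw, hi, hs⟩ := hc
  obtain ⟨q, s, a, b, hm, rfl⟩ := h
  obtain ⟨st, p, wh, tape⟩ := c
  simp only at hw hi hs hm ⊢
  rcases hs with hs | ⟨hs, -⟩ <;> rw [hs] at hm ⊢
  · cases p with
    | zero =>
      simp [parityMachine, Machine.readInput] at hm
      obtain ⟨rfl, -, rfl, rfl⟩ := hm
      simp [ParityInvariant, Machine.moveInput, Machine.moveWork, hw]
      exact ⟨rfl, Option.some_ne_none _⟩
    | succ p =>
      rcases (Nat.le_of_succ_le_succ hi).lt_or_eq with hp | hp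
      · rw [Machine.readInput, List.getElem?_eq_getElem hp] at hm
        simp [parityMachine] at hm
        obtain ⟨rfl, -, rfl, rfl⟩ := hm
        refine ⟨⟨hw, ?_, Or.inl ?_⟩, Or.inl ?_, Option.some_ne_none _⟩
        · simp [Machine.moveInput]
        · have : min (p + 1 + 1) (w.length + 1) - 1 = p + 1 := by omega
          simp only [Machine.moveInput, this, decide_odd_count_take_succ hp]
          rfl
        · simp only [Machine.moveInput]; omega
      · rw [Machine.readInput, List.getElem?_eq_none hp.ge] at hm
        subst hp
        by_cases ho : Odd (w.count true)
        · simp [parityMachine, ho] at hm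
          obtain ⟨rfl, -, rfl, rfl⟩ := hm
          exact ⟨⟨hw, by simp [Machine.moveInput], Or.inr ⟨rfl, ho⟩⟩, Or.inr rfl,
            Option.some_ne_none _⟩
        · simp [parityMachine, ho] at hm
          exact hm.elim
  · simp [parityMachine] at hm
    exact hm.elim

theorem parityInvariant_init (w : List Bool) : ParityInvariant w parityMachine.init :=
  ⟨rfl, Nat.zero_le _, Or.inl (by simp [Machine.init, parityMachine])⟩

theorem parityInvariant_of_reaches {w : List Bool} {c : parityMachine.Config}
    (h : parityMachine.Reaches w c) : ParityInvariant w c := by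
  induction h with
  | refl => exact parityInvariant_init w
  | tail _ h ih => exact (parityMachine_step ih h).1

theorem parityMachine_haltsOn (w : List Bool) : parityMachine.HaltsOn w := by
  rintro ⟨c, h0, hstep⟩
  have hinv : ∀ i, ParityInvariant w (c i) := by
    intro i
    induction i with
    | zero => rw [h0]; exact parityInvariant_init w
    | succ i ih => exact (parityMachine_step ih (hstep i)).1
  -- In an infinite computation every configuration has a successor, so none is accepting and the
  -- head must advance at each step, past the right end marker.
  have hhead : ∀ i, (c i).inputHead = i := by
    intro i
    induction i with
    | zero => rw [h0]; rfl
    | succ i ih =>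
      rcases (parityMachine_step (hinv i) (hstep i)).2.1 with h | h
      · rw [h, ih]
      · exact absurd h (parityMachine_step (hinv (i + 1)) (hstep (i + 1))).2.2
  have := (hinv (w.length + 2)).2.1
  rw [hhead] at this
  omega

theorem parityMachine_isLogspace : parityMachine.IsLogspace := by
  refine ⟨1, fun w => ⟨parityMachine_haltsOn w, fun c hc => ?_⟩⟩
  rw [(parityInvariant_of_reaches hc).1]
  omega

theorem parityMachine_accepts (w : List Bool) : parityMachine.Accepts w ↔ w ∈ Parity := by
  constructor
  · rintro ⟨c, hc, hacc⟩
    have hacc : c.state = none := hacc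
    rcases (parityInvariant_of_reaches hc).2.2 with h | h
    · rw [hacc] at h; cases h
    · exact h.2
  · intro hodd
    have hodd : Odd (w.count true) := hodd
    have key : ∀ p ≤ w.length, parityMachine.Reaches w
        ⟨some (decide (Odd ((w.take p).count true))), p + 1, 0, fun _ => ()⟩ := by
      intro p
      induction p with
      | zero =>
        intro _
        refine Relation.ReflTransGen.single ⟨some false, (), .right, .stay, ?_, ?_⟩
        · exact Set.mem_singleton _
        · simp only [Machine.moveInput, Nat.zero_add]
          rfl
      | succ p ih =>
        intro hp
        refine (ih (by omega)).tail
          ⟨some (decide (Odd ((w.take (p + 1)).count true))), (), .right, .stay, ?_, ?_⟩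
        · simp only [Machine.readInput, List.getElem?_eq_getElem hp]
          rw [decide_odd_count_take_succ hp]
          exact Set.mem_singleton _
        · have : min (p + 1 + 1) (w.length + 1) = p + 1 + 1 := by omega
          simp only [Machine.moveInput, this]
          rfl
    refine ⟨⟨none, w.length + 1, 0, fun _ => ()⟩, (key _ le_rfl).tail
      ⟨none, (), .stay, .stay, ?_, ?_⟩, rfl⟩
    · simp only [Machine.readInput, List.getElem?_eq_none le_rfl, List.take_length, hodd,
        decide_true]
      exact Set.mem_singleton _
    · rfl

theorem parity_mem_Logspace : Parity ∈ Logspace :=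
  ⟨parityMachine, parityMachine_isDeterministic, parityMachine_isLogspace, parityMachine_accepts⟩

theorem parity_mem_NLogspace : Parity ∈ NLogspace :=
  ⟨parityMachine, parityMachine_isLogspace, parityMachine_accepts⟩

/-! ### Functions of low degree on the Boolean cube -/

/-- The sign of a bit. -/
def bitSign (b : Bool) : ZMod 3 := if b then -1 else 1

/-- The bit as an element of the field with three elements. -/
def bitVal (b : Bool) : ZMod 3 := if b then 1 else 0

/-- The characters of the Boolean cube. -/
def character {n : ℕ} (S : Finset (Fin n)) (x : Fin n → Bool) : ZMod 3 := ∏ i ∈ S, bitSign (x i)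

/-- The functions on the Boolean cube of degree at most `D` over the field with three elements. -/
def lowDegree (n D : ℕ) : Submodule (ZMod 3) ((Fin n → Bool) → ZMod 3) :=
  Submodule.span (ZMod 3) (character '' {S | S.card ≤ D})

section LowDegree

variable {n : ℕ}

theorem character_mem {S : Finset (Fin n)} {D : ℕ} (h : S.card ≤ D) :
    character S ∈ lowDegree n D :=
  Submodule.subset_span ⟨S, h, rfl⟩

theorem lowDegree_mono {D D' : ℕ} (h : D ≤ D') : lowDegree n D ≤ lowDegree n D' :=
  Submodule.span_mono (Set.image_mono fun _ hS => le_trans hS h)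

theorem one_mem_lowDegree (D : ℕ) : (1 : (Fin n → Bool) → ZMod 3) ∈ lowDegree n D := by
  have h : character (∅ : Finset (Fin n)) = 1 := by
    funext x
    simp [character]
  rw [← h]
  exact character_mem (by simp)

/-- Signs square to one, so the factors common to both sets cancel. -/
theorem character_mul (S T : Finset (Fin n)) :
    character S * character T = character (symmDiff S T) := by
  funext x
  have hsq : ∀ b, bitSign b * bitSign b = 1 := by decide
  have h1 : character (S ∩ T) x * character (S ∩ T) x = 1 := by
    simp only [character, ← Finset.prod_mul_distrib, hsq, Finset.prod_const_one]
  have h2 : character S x = character (S \ T) x * character (S ∩ T) x := by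
    simp only [character]
    rw [mul_comm, Finset.prod_inter_mul_prod_sdiff]
  have h3 : character T x = character (T \ S) x * character (S ∩ T) x := by
    simp only [character]
    rw [mul_comm, Finset.inter_comm, Finset.prod_inter_mul_prod_sdiff]
  have h4 : character (symmDiff S T) x = character (S \ T) x * character (T \ S) x := by
    simp only [character]
    exact Finset.prod_union disjoint_sdiff_sdiff
  rw [Pi.mul_apply, h2, h3, h4, mul_mul_mul_comm, h1, mul_one]

theorem mul_mem_lowDegree {a b : ℕ} {f g : (Fin n → Bool) → ZMod 3} (hf : f ∈ lowDegree n a)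
    (hg : g ∈ lowDegree n b) : f * g ∈ lowDegree n (a + b) := by
  have h := Submodule.mul_mem_mul hf hg
  rw [lowDegree, lowDegree, Submodule.span_mul_span] at h
  refine Submodule.span_le.2 ?_ h
  rintro _ ⟨_, ⟨S, hS, rfl⟩, _, ⟨T, hT, rfl⟩, rfl⟩
  simp only [character_mul]
  refine character_mem ?_
  calc (symmDiff S T).card ≤ (S \ T).card + (T \ S).card := Finset.card_union_le _ _
    _ ≤ a + b := add_le_add ((Finset.card_le_card Finset.sdiff_subset).trans hS)
        ((Finset.card_le_card Finset.sdiff_subset).trans hT)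

theorem prod_mem_lowDegree {ι : Type*} {D : ℕ} {s : Finset ι} {f : ι → (Fin n → Bool) → ZMod 3}
    (hf : ∀ i ∈ s, f i ∈ lowDegree n D) : ∏ i ∈ s, f i ∈ lowDegree n (s.card * D) := by
  classical
  induction s using Finset.induction_on with
  | empty => simpa using one_mem_lowDegree 0
  | insert i s hi ih =>
    rw [Finset.prod_insert hi, Finset.card_insert_of_notMem hi, add_mul, one_mul, add_comm]
    exact mul_mem_lowDegree (hf i (Finset.mem_insert_self _ _))
      (ih fun j hj => hf j (Finset.mem_insert_of_mem hj))

theorem bitVal_mem_lowDegree (i : Fin n) : (fun x => bitVal (x i)) ∈ lowDegree n 1 := by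
  -- For a bit one this reads `-1 - 1 = 1`, which is true modulo three.
  have h : (fun x : Fin n → Bool => bitVal (x i)) = character {i} - 1 := by
    funext x
    simp only [character, Finset.prod_singleton, Pi.sub_apply, Pi.one_apply]
    cases x i <;> decide
  rw [h]
  exact sub_mem (character_mem (by simp)) (one_mem_lowDegree 1)

/-- Interpolation: the indicator function of a point is a product of `n` functions of degree one,
one per coordinate. -/
theorem lowDegree_self : lowDegree n n = ⊤ := by
  classical
  rw [eq_top_iff]
  intro f _
  have hlit : ∀ (a : Fin n → Bool) (i : Fin n),
      (fun x : Fin n → Bool => if x i = a i then (1 : ZMod 3) else 0) ∈ lowDegree n 1 := by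
    intro a i
    cases h : a i
    · convert sub_mem (one_mem_lowDegree 1) (bitVal_mem_lowDegree i) using 1
      funext x
      simp only [Pi.sub_apply, Pi.one_apply]
      cases x i <;> rfl
    · exact bitVal_mem_lowDegree i
  have hf : f = ∑ a, f a • ∏ i, fun x : Fin n → Bool => if x i = a i then (1 : ZMod 3) else 0 := by
    funext x
    simp only [Finset.sum_apply, Pi.smul_apply, Finset.prod_apply, smul_eq_mul]
    rw [Finset.sum_eq_single x]
    · simp
    · intro a _ ha
      obtain ⟨i, hi⟩ := Function.ne_iff.1 ha
      rw [Finset.prod_eq_zero (Finset.mem_univ i) (if_neg hi.symm), mul_zero]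
    · simp
  rw [hf]
  refine sum_mem fun a _ => Submodule.smul_mem _ _ ?_
  simpa using prod_mem_lowDegree (s := Finset.univ) fun i _ => hlit a i

/-- A function of low degree agrees with the parity function on few points only. -/
theorem card_le_of_eq_character_univ {m D : ℕ} {p : (Fin (2 * m) → Bool) → ZMod 3}
    (hp : p ∈ lowDegree (2 * m) D) (G : Finset (Fin (2 * m) → Bool))
    (hG : ∀ x ∈ G, p x = character Finset.univ x) :
    G.card ≤ (Finset.univ.filter fun S : Finset (Fin (2 * m)) => S.card ≤ m + D).card := by
  classical
  let R : ((Fin (2 * m) → Bool) → ZMod 3) →ₗ[ZMod 3] (G → ZMod 3) :=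
    LinearMap.funLeft (ZMod 3) (ZMod 3) Subtype.val
  have hR : Function.Surjective R := LinearMap.funLeft_surjective_of_injective _ _ _
    Subtype.val_injective
  -- A character of a set `S` with more than `m` elements is the full character times that of `Sᶜ`,
  -- and on `G` the former may be replaced by `p`. So every function on `G` has degree at most `m +
  -- D`, and `G.card` is bounded by the dimension of that space.
  have hmap : (lowDegree (2 * m) (m + D)).map R = ⊤ := by
    rw [eq_top_iff, ← LinearMap.range_eq_top.2 hR, ← Submodule.map_top, ← lowDegree_self,
      lowDegree, Submodule.map_span, Submodule.span_le]
    rintro _ ⟨_, ⟨S, -, rfl⟩, rfl⟩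
    rcases Nat.lt_or_ge m S.card with h | h
    · refine ⟨p * character Sᶜ, lowDegree_mono ?_ (mul_mem_lowDegree hp (character_mem le_rfl)), ?_⟩
      · rw [Finset.card_compl, Fintype.card_fin]
        omega
      · funext x
        change p x * character Sᶜ x = character S x
        rw [hG x x.2, ← Pi.mul_apply, character_mul]
        congr 1
        ext i
        simp [Finset.mem_symmDiff]
    · exact ⟨_, character_mem (by omega), rfl⟩
  have h1 : G.card = Module.finrank (ZMod 3) ((lowDegree (2 * m) (m + D)).map R) := by
    rw [hmap, finrank_top, Module.finrank_pi, Fintype.card_coe]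
  have h2 : Module.finrank (ZMod 3) (lowDegree (2 * m) (m + D)) ≤
      (Finset.univ.filter fun S : Finset (Fin (2 * m)) => S.card ≤ m + D).card := by
    have hset : character '' {S : Finset (Fin (2 * m)) | S.card ≤ m + D} =
        ((Finset.univ.filter fun S : Finset (Fin (2 * m)) => S.card ≤ m + D).image character :
          Finset _) := by
      simp
    rw [lowDegree, hset]
    exact (finrank_span_finset_le_card _).trans Finset.card_image_le
  rw [h1]
  exact (Submodule.finrank_map_le _ _).trans h2

end LowDegree

/-- Induction by the recurrence for central binomial coefficients, using `(2 * m + 1) * (2 * m + 3)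
≤ 4 * (m + 1) ^ 2`. It shows that a single layer of the cube holds only a fraction of order `1 /
√m`. -/
theorem centralBinom_sq_le (m : ℕ) : m.centralBinom ^ 2 * (2 * m + 1) ≤ 16 ^ m := by
  induction m with
  | zero => simp
  | succ m ih =>
    have h := Nat.succ_mul_centralBinom_succ m
    have h2 : (m + 1) ^ 2 * ((m + 1).centralBinom ^ 2 * (2 * (m + 1) + 1)) ≤
        (m + 1) ^ 2 * 16 ^ (m + 1) := by
      calc (m + 1) ^ 2 * ((m + 1).centralBinom ^ 2 * (2 * (m + 1) + 1))
          = ((m + 1) * (m + 1).centralBinom) ^ 2 * (2 * m + 3) := by ring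
        _ = m.centralBinom ^ 2 * (2 * m + 1) * (4 * (2 * m + 1) * (2 * m + 3)) := by
            rw [h]; ring
        _ ≤ 16 ^ m * (4 * (2 * m + 1) * (2 * m + 3)) := Nat.mul_le_mul_right _ ih
        _ ≤ 16 ^ m * (16 * (m + 1) ^ 2) := Nat.mul_le_mul_left _ (by nlinarith)
        _ = (m + 1) ^ 2 * 16 ^ (m + 1) := by ring
    exact Nat.le_of_mul_le_mul_left h2 (by positivity)

/-- By complementation at most half of all sets lie below the middle layer, and each of the `D + 1`
layers from `m` to `m + D` has at most the central binomial number of sets. -/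
theorem card_filter_card_le (m D : ℕ) :
    2 * (Finset.univ.filter fun S : Finset (Fin (2 * m)) => S.card ≤ m + D).card ≤
      4 ^ m + 2 * ((D + 1) * m.centralBinom) := by
  classical
  set A := Finset.univ.filter fun S : Finset (Fin (2 * m)) => S.card < m
  set B := Finset.univ.filter fun S : Finset (Fin (2 * m)) => m < S.card
  have hAB : A.card = B.card := by
    refine Finset.card_bij' (fun S _ => Sᶜ) (fun S _ => Sᶜ) ?_ ?_ ?_ ?_
    · intro S hS
      simp only [A, B, Finset.mem_filter, Finset.mem_univ, true_and, Finset.card_compl,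
        Fintype.card_fin] at hS ⊢
      omega
    · intro S hS
      simp only [A, B, Finset.mem_filter, Finset.mem_univ, true_and, Finset.card_compl,
        Fintype.card_fin] at hS ⊢
      have := S.card_le_univ
      rw [Fintype.card_fin] at this
      omega
    · simp
    · simp
  have hdisj : Disjoint A B := by
    rw [Finset.disjoint_left]
    intro S hS hS'
    simp only [A, B, Finset.mem_filter, Finset.mem_univ, true_and] at hS hS'
    omega
  have h1 : 2 * A.card ≤ 4 ^ m := by
    calc 2 * A.card = (A ∪ B).card := by rw [Finset.card_union_of_disjoint hdisj, ← hAB, two_mul]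
      _ ≤ Fintype.card (Finset (Fin (2 * m))) := Finset.card_le_univ _
      _ = 4 ^ m := by rw [Fintype.card_finset, Fintype.card_fin, pow_mul]; norm_num
  have h2 : (Finset.univ.filter fun S : Finset (Fin (2 * m)) => S.card ≤ m + D) ⊆
      A ∪ (Finset.range (D + 1)).biUnion fun i => Finset.powersetCard (m + i) Finset.univ := by
    intro S hS
    simp only [A, Finset.mem_filter, Finset.mem_univ, true_and, Finset.mem_union,
      Finset.mem_biUnion, Finset.mem_range, Finset.mem_powersetCard, Finset.subset_univ] at hS ⊢
    rcases Nat.lt_or_ge S.card m with h | h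
    · exact Or.inl h
    · exact Or.inr ⟨S.card - m, by omega, by omega⟩
  have h3 : ((Finset.range (D + 1)).biUnion fun i =>
      Finset.powersetCard (m + i) (Finset.univ : Finset (Fin (2 * m)))).card ≤
        (D + 1) * m.centralBinom := by
    refine Finset.card_biUnion_le.trans ?_
    calc _ ≤ ∑ i ∈ Finset.range (D + 1), m.centralBinom := Finset.sum_le_sum fun i _ => by
          rw [Finset.card_powersetCard, Finset.card_univ, Fintype.card_fin]
          exact Nat.choose_le_centralBinom _ _
      _ = _ := by simp
  have h4 := (Finset.card_le_card h2).trans (Finset.card_union_le _ _)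
  omega

/-! ### Approximation of Boolean gates -/

/-- Some partial sum vanishes on at most half of the points at which some summand does
not vanish. -/
theorem exists_subset_sum_ne_zero {W X : Type*} {K : Type*} [AddCommGroup K] [DecidableEq K]
    (s : Finset W)
    (q : W → X → K) (B : Finset X) (hB : ∀ x ∈ B, ∃ w ∈ s, q w x ≠ 0) :
    ∃ r ⊆ s, 2 * (B.filter fun x => ∑ w ∈ r, q w x = 0).card ≤ B.card := by
  classical
  have hx : ∀ x ∈ B, 2 * (s.powerset.filter fun r => ∑ w ∈ r, q w x = 0).card ≤
      s.powerset.card := by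
    intro x hx
    obtain ⟨w, hw, hne⟩ := hB x hx
    -- Toggling the membership of `w` changes the sum by a nonzero amount, so it maps vanishing
    -- partial sums injectively to nonvanishing ones.
    have hle : (s.powerset.filter fun r => ∑ w ∈ r, q w x = 0).card ≤
        (s.powerset.filter fun r => ¬ ∑ w ∈ r, q w x = 0).card := by
      refine Finset.card_le_card_of_injOn (fun r => symmDiff r {w}) ?_ ?_
      · intro r hr
        simp only [Finset.coe_filter, Finset.mem_powerset, Set.mem_ofPred_eq] at hr ⊢
        by_cases hwr : w ∈ r
        · have e : symmDiff r {w} = r.erase w := by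
            ext z; simp only [Finset.mem_symmDiff, Finset.mem_singleton, Finset.mem_erase]
            grind
          rw [e]
          refine ⟨(Finset.erase_subset _ _).trans hr.1, fun h => hne ?_⟩
          rw [← Finset.add_sum_erase _ _ hwr, h, add_zero] at hr
          exact hr.2
        · have e : symmDiff r {w} = insert w r := by
            ext z; simp only [Finset.mem_symmDiff, Finset.mem_singleton, Finset.mem_insert]
            grind
          rw [e, Finset.sum_insert hwr, hr.2, add_zero]
          exact ⟨Finset.insert_subset hw hr.1, hne⟩
      · exact (symmDiff_left_injective ({w} : Finset W)).injOn
    have := Finset.card_filter_add_card_filter_not (s := s.powerset)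
      (fun r => ∑ w ∈ r, q w x = 0)
    omega
  -- Averaging over `r`: each point of `B` is bad for at most half of the subsets, so not every
  -- subset is bad for more than half of the points.
  by_contra! hcon
  have hsum : ∑ r ∈ s.powerset, 2 * (B.filter fun x => ∑ w ∈ r, q w x = 0).card =
      ∑ x ∈ B, 2 * (s.powerset.filter fun r => ∑ w ∈ r, q w x = 0).card := by
    simp only [Finset.card_filter, ← Finset.mul_sum]
    rw [Finset.sum_comm]
  have h1 : ∑ r ∈ s.powerset, B.card <
      ∑ r ∈ s.powerset, 2 * (B.filter fun x => ∑ w ∈ r, q w x = 0).card :=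
    Finset.sum_lt_sum_of_nonempty ⟨∅, Finset.empty_mem_powerset s⟩ fun r hr =>
      hcon r (Finset.mem_powerset.1 hr)
  have h2 := Finset.sum_le_sum hx
  rw [hsum] at h1
  simp only [Finset.sum_const, smul_eq_mul] at h1 h2
  rw [mul_comm] at h2
  exact absurd h1 (not_lt.2 h2)

/-- The approximation of an unbounded fan-in NOR by a function of low degree. -/
theorem exists_nor_approximation {n D : ℕ} {W : Type*} (s : Finset W)
    (q : W → (Fin n → Bool) → ZMod 3) (hq : ∀ w ∈ s, q w ∈ lowDegree n D) (t : ℕ) :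
    ∃ f ∈ lowDegree n (2 * t * D), (∀ x, (∀ w ∈ s, q w x = 0) → f x = 1) ∧
      (Finset.univ.filter fun x => (∃ w ∈ s, q w x ≠ 0) ∧ f x ≠ 0).card * 2 ^ t ≤ 2 ^ n := by
  classical
  induction t with
  | zero =>
    refine ⟨1, one_mem_lowDegree _, fun _ _ => rfl, ?_⟩
    rw [pow_zero, mul_one]
    refine (Finset.card_le_univ _).trans ?_
    simp
  | succ t ih =>
    obtain ⟨f, hf, hf1, hcard⟩ := ih
    set B := Finset.univ.filter fun x => (∃ w ∈ s, q w x ≠ 0) ∧ f x ≠ 0 with hB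
    obtain ⟨r, hr, hr2⟩ := exists_subset_sum_ne_zero s q B fun x hx => (Finset.mem_filter.1 hx).2.1
    have hsum : ∑ w ∈ r, q w ∈ lowDegree n D := sum_mem fun w hw => hq w (hr hw)
    have hval : ∀ a : ZMod 3, 1 - a * a ≠ 0 → a = 0 := by decide
    -- Nonzero squares are `1` modulo three, so the new factor vanishes wherever the partial sum
    -- does not and equals `1` where all `q w` vanish. Each round halves the error and adds `2 * D`
    -- to the degree.
    refine ⟨f * (1 - (∑ w ∈ r, q w) * ∑ w ∈ r, q w), ?_, fun x hx => ?_, ?_⟩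
    · rw [show 2 * (t + 1) * D = 2 * t * D + (D + D) by ring]
      exact mul_mem_lowDegree hf (sub_mem (one_mem_lowDegree _) (mul_mem_lowDegree hsum hsum))
    · simp only [Pi.mul_apply, Pi.sub_apply, Pi.one_apply, Finset.sum_apply]
      rw [hf1 x hx, Finset.sum_eq_zero fun w hw => hx w (hr hw)]
      decide
    · have hsub : (Finset.univ.filter fun x => (∃ w ∈ s, q w x ≠ 0) ∧
          (f * (1 - (∑ w ∈ r, q w) * ∑ w ∈ r, q w)) x ≠ 0) ⊆
          B.filter fun x => ∑ w ∈ r, q w x = 0 := by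
        intro x hx
        simp only [hB, Finset.mem_filter, Finset.mem_univ, true_and, Pi.mul_apply, Pi.sub_apply,
          Pi.one_apply, Finset.sum_apply] at hx ⊢
        exact ⟨⟨hx.1, left_ne_zero_of_mul hx.2⟩, hval _ (right_ne_zero_of_mul hx.2)⟩
      calc _ ≤ (B.filter fun x => ∑ w ∈ r, q w x = 0).card * 2 ^ (t + 1) :=
            Nat.mul_le_mul_right _ (Finset.card_le_card hsub)
        _ = 2 * (B.filter fun x => ∑ w ∈ r, q w x = 0).card * 2 ^ t := by ring
        _ ≤ B.card * 2 ^ t := Nat.mul_le_mul_right _ hr2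
        _ ≤ 2 ^ n := hcard

/-- The approximation of a gate of an `AC⁰` circuit. -/
theorem exists_gate_approximation {n t : ℕ} (ht : 0 < t) {W : Type} (g : Gate W) (hg : g.IsAC)
    (v : (Fin n → Bool) → W → Bool) (q : W → (Fin n → Bool) → ZMod 3) (dep : W → ℕ)
    (hq : ∀ w, q w ∈ lowDegree n ((2 * t) ^ dep w)) :
    ∃ f ∈ lowDegree n ((2 * t) ^ g.depth dep), ∃ E : Finset (Fin n → Bool),
      E.card * 2 ^ t ≤ g.cost * 2 ^ n ∧
      ∀ x ∉ E, (∀ w, q w x = bitVal (v x w)) → f x = bitVal (g.eval (v x)) := by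
  classical
  have hle : ∀ (s : Finset W), ∀ w ∈ s, q w ∈ lowDegree n ((2 * t) ^ s.sup dep) := fun s w hw =>
    lowDegree_mono (Nat.pow_le_pow_right (by omega) (Finset.le_sup hw)) (hq w)
  have hpow : ∀ d, (2 * t) ^ (d + 1) = 2 * t * (2 * t) ^ d := fun d => pow_succ' _ _
  have hone : ∀ b, 1 - bitVal b = bitVal (!b) := by decide
  have hzero : ∀ b, bitVal b = 0 ↔ b = false := by decide
  cases g with
  | not w =>
    -- Negation is exact and keeps the degree, in line with NOT gates having neither cost nor depth.
    refine ⟨1 - q w, sub_mem (one_mem_lowDegree _) (hq w), ∅, by simp, fun x _ hx => ?_⟩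
    rw [Pi.sub_apply, Pi.one_apply, hx, hone]
    rfl
  | and s =>
    -- A conjunction is the NOR of the negated wires.
    obtain ⟨f, hf, hf1, hc⟩ := exists_nor_approximation s (fun w => 1 - q w)
      (fun w hw => sub_mem (one_mem_lowDegree _) (hle s w hw)) t
    refine ⟨f, by simpa only [Gate.depth, hpow] using hf, _, by rwa [show (Gate.and s).cost = 1 from rfl, one_mul], fun x hx hqx => ?_⟩
    simp only [Pi.sub_apply, Pi.one_apply, hqx, hone, Finset.mem_filter, Finset.mem_univ,
      true_and, ne_eq, hzero] at hx hf1 ⊢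
    by_cases h : ∀ w ∈ s, v x w = true
    · rw [hf1 x fun w hw => by rw [hqx, hone, h w hw]; rfl, Gate.eval, decide_eq_true h]
      rfl
    · rw [Gate.eval, decide_eq_false h]
      push Not at h hx
      obtain ⟨w, hw, h⟩ := h
      exact hx ⟨w, hw, by simpa using h⟩
  | or s =>
    obtain ⟨f, hf, hf1, hc⟩ := exists_nor_approximation s q (hle s) t
    refine ⟨1 - f, sub_mem (one_mem_lowDegree _) (by simpa only [Gate.depth, hpow] using hf), _,
      by rwa [show (Gate.or s).cost = 1 from rfl, one_mul], fun x hx hqx => ?_⟩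
    simp only [hqx, Finset.mem_filter, Finset.mem_univ, true_and, ne_eq, hzero] at hx
    rw [Pi.sub_apply, Pi.one_apply]
    by_cases h : ∃ w ∈ s, v x w = true
    · rw [Gate.eval, decide_eq_true h]
      push Not at hx
      obtain ⟨w, hw, h⟩ := h
      rw [hx ⟨w, hw, by simpa using h⟩]
      rfl
    · rw [Gate.eval, decide_eq_false h]
      push Not at h
      rw [hf1 x fun w hw => by rw [hqx, hzero]; simpa using h w hw]
      rfl
  | mod m s => exact hg.elim
  | maj s => exact hg.elim

/-- The approximation of an `AC⁰` circuit. -/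
theorem exists_circuit_approximation {n M t : ℕ} (ht : 0 < t) (C : Circuit n M)
    (hC : ∀ i, (C.gate i).IsAC) :
    ∃ (p : Fin C.numGates → (Fin n → Bool) → ZMod 3) (E : Finset (Fin n → Bool)),
      (∀ i, p i ∈ lowDegree n ((2 * t) ^ C.gateDepth i)) ∧ E.card * 2 ^ t ≤ C.size * 2 ^ n ∧
      ∀ x ∉ E, ∀ i, p i x = bitVal (C.gateVal x i) := by
  classical
  -- Gates are approximated one at a time in topological order. The error sets are united, so their
  -- total measure is governed by the size and does not compound with the depth.
  have key : ∀ k ≤ C.numGates, ∃ (p : Fin C.numGates → (Fin n → Bool) → ZMod 3)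
      (E : Finset (Fin n → Bool)),
      (∀ i, i.val < k → p i ∈ lowDegree n ((2 * t) ^ C.gateDepth i)) ∧
      E.card * 2 ^ t ≤ (∑ i : Fin C.numGates with i.val < k, (C.gate i).cost) * 2 ^ n ∧
      ∀ x ∉ E, ∀ i, i.val < k → p i x = bitVal (C.gateVal x i) := by
    intro k
    induction k with
    | zero => exact fun _ => ⟨0, ∅, by simp, by simp, by simp⟩
    | succ k ih =>
      intro hk
      obtain ⟨p, E, hp, hE, hpE⟩ := ih (by omega)
      let K : Fin C.numGates := ⟨k, hk⟩
      let q : Fin n ⊕ Fin K.val → (Fin n → Bool) → ZMod 3 :=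
        Sum.elim (fun i x => bitVal (x i)) fun i : Fin k => p ⟨i, i.isLt.trans hk⟩
      obtain ⟨f, hf, E', hE', hfE⟩ := exists_gate_approximation ht (C.gate K) (hC K)
        (fun x => Sum.elim x fun i => C.gateVal x ⟨i, i.isLt.trans hk⟩) q
        (Sum.elim (fun _ => 0) fun i => C.gateDepth ⟨i, i.isLt.trans hk⟩) (by
          rintro (i | i)
          · simpa [q] using bitVal_mem_lowDegree i
          · exact hp _ i.isLt)
      have hd : C.gateDepth K = (C.gate K).depth
          (Sum.elim (fun _ => 0) fun i : Fin k => C.gateDepth ⟨i, i.isLt.trans hk⟩) := by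
        rw [Circuit.gateDepth]
        congr 1
        funext w
        cases w <;> rfl
      have hv : ∀ x, C.gateVal x K = (C.gate K).eval
          (Sum.elim x fun i : Fin k => C.gateVal x ⟨i, i.isLt.trans hk⟩) := by
        intro x
        rw [Circuit.gateVal]
        congr 1
        funext w
        cases w <;> rfl
      have hne : ∀ i : Fin C.numGates, i.val < k → i ≠ K := fun i hi h => by
        rw [h] at hi
        exact lt_irrefl _ hi
      have hlast : ∀ i : Fin C.numGates, i.val < k + 1 → i.val < k ∨ i = K := fun i hi =>
        (Nat.lt_succ_iff_lt_or_eq.1 hi).imp_right fun h => Fin.ext h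
      refine ⟨Function.update p K f, E ∪ E', fun i hi => ?_, ?_, fun x hx i hi => ?_⟩
      · rcases hlast i hi with h | rfl
        · rw [Function.update_of_ne (hne i h)]
          exact hp i h
        · rw [Function.update_self, hd]
          exact hf
      · have hs : (Finset.univ.filter fun i : Fin C.numGates => i.val < k + 1) =
            insert K (Finset.univ.filter fun i : Fin C.numGates => i.val < k) := by
          ext i
          simp only [Finset.mem_filter, Finset.mem_univ, true_and, Finset.mem_insert, Fin.ext_iff,
            K]
          omega
        rw [hs, Finset.sum_insert (by simp [K])]
        calc (E ∪ E').card * 2 ^ t ≤ (E.card + E'.card) * 2 ^ t :=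
              Nat.mul_le_mul_right _ (Finset.card_union_le _ _)
          _ ≤ _ := by rw [add_mul, add_mul, add_comm]; exact add_le_add hE' hE
      · rw [Finset.notMem_union] at hx
        rcases hlast i hi with h | rfl
        · rw [Function.update_of_ne (hne i h)]
          exact hpE x hx.1 i h
        · rw [Function.update_self, hv]
          refine hfE x hx.2 fun w => ?_
          rcases w with j | j
          · rfl
          · exact hpE x hx.1 _ j.isLt
  obtain ⟨p, E, hp, hE, hpE⟩ := key _ le_rfl
  refine ⟨p, E, fun i => hp i i.isLt, ?_, fun x hx i => hpE x hx i i.isLt⟩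
  simpa [Circuit.size] using hE

/-- If `AC⁰` circuits compute functions such that few output bits certify that the input has an odd
number of ones, then the circuits are large or deep. -/
theorem le_of_parity_certificates {m M t d w : ℕ} (ht : 0 < t) (C : Circuit (2 * m) M)
    (hC : ∀ i, (C.gate i).IsAC) (hd : C.depth ≤ d) (hsize : 8 * C.size ≤ 2 ^ t)
    (Q : (Fin (2 * m) → Bool) → Finset (Fin M)) (hQw : ∀ a, (Q a).card ≤ w)
    (hQ : ∀ a x : Fin (2 * m) → Bool, Odd (Finset.univ.filter fun j => a j = true).card →
      ¬ Odd (Finset.univ.filter fun j => x j = true).card → ∃ j ∈ Q a, C.eval x j ≠ C.eval a j) :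
    2 * m + 1 ≤ 16 * (6 * (w * (2 * t) ^ d) + 1) ^ 2 := by
  classical
  obtain ⟨p, E, hp, hE, hpE⟩ := exists_circuit_approximation ht C hC
  let o : Fin M → (Fin (2 * m) → Bool) → ZMod 3 := fun j =>
    Sum.elim (fun i x => bitVal (x i)) p (C.output j)
  have ho : ∀ j, o j ∈ lowDegree (2 * m) ((2 * t) ^ d) := by
    intro j
    have hpos : 0 < (2 * t) ^ d := by positivity
    simp only [o]
    rcases C.output j with i | i
    · exact lowDegree_mono hpos (bitVal_mem_lowDegree i)
    · exact lowDegree_mono (Nat.pow_le_pow_right (by omega)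
        ((Finset.le_sup (f := C.gateDepth) (Finset.mem_univ i)).trans hd)) (hp i)
  have hoE : ∀ x ∉ E, ∀ j, o j x = bitVal (C.eval x j) := by
    intro x hx j
    simp only [o, Circuit.eval]
    rcases C.output j with i | i
    · rfl
    · exact hpE x hx i
  -- Off `E`, the function `T a` indicates agreement with `a` on the certificate `Q a`. The product
  -- is taken exactly, so its degree grows by the factor `w`.
  let T : (Fin (2 * m) → Bool) → (Fin (2 * m) → Bool) → ZMod 3 := fun a =>
    ∏ j ∈ Q a, if C.eval a j then o j else 1 - o j
  have hT : ∀ a, T a ∈ lowDegree (2 * m) (w * (2 * t) ^ d) := fun a =>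
    lowDegree_mono (Nat.mul_le_mul_right _ (hQw a)) (prod_mem_lowDegree fun j _ => by
      split
      · exact ho j
      · exact sub_mem (one_mem_lowDegree _) (ho j))
  have hTE : ∀ a, ∀ x ∉ E, T a x = if ∀ j ∈ Q a, C.eval x j = C.eval a j then 1 else 0 := by
    intro a x hx
    have hfac : ∀ j, (if C.eval a j then o j else 1 - o j) x =
        if C.eval x j = C.eval a j then 1 else 0 := by
      intro j
      have := hoE x hx j
      cases h1 : C.eval a j <;> cases h2 : C.eval x j <;> simp [this, h2, bitVal]
    simp only [T, Finset.prod_apply, hfac]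
    split_ifs with h
    · exact Finset.prod_eq_one fun j hj => if_pos (h j hj)
    · push Not at h
      obtain ⟨j, hj, h⟩ := h
      exact Finset.prod_eq_zero hj (if_neg h)
  set O := Finset.univ.filter fun a : Fin (2 * m) → Bool =>
    Odd (Finset.univ.filter fun j => a j = true).card with hO
  -- The NOR runs over all odd words, yet three rounds suffice for an error of one eighth and
  -- multiply the degree by six only.
  obtain ⟨f, hf, hf1, hf2⟩ := exists_nor_approximation O T (fun a _ => hT a) 3
  set E' := Finset.univ.filter fun x => (∃ w ∈ O, T w x ≠ 0) ∧ f x ≠ 0 with hE'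
  have hchar : ∀ x : Fin (2 * m) → Bool, character Finset.univ x =
      if Odd (Finset.univ.filter fun j => x j = true).card then -1 else 1 := by
    intro x
    simp only [character, bitSign]
    rw [Finset.prod_ite, Finset.prod_const, Finset.prod_const_one, mul_one]
    split_ifs with h
    · exact h.neg_one_pow
    · exact (Nat.not_odd_iff_even.1 h).neg_one_pow
  -- Off the error sets `f` is `0` on odd and `1` on even words, so `2 * f - 1` is the parity
  -- character.
  have hG := card_le_of_eq_character_univ (p := f + f - 1)
    (sub_mem (add_mem hf hf) (one_mem_lowDegree _)) (E ∪ E')ᶜ (by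
      intro x hx
      rw [Finset.mem_compl, Finset.notMem_union] at hx
      rw [hchar, Pi.sub_apply, Pi.add_apply, Pi.one_apply]
      split_ifs with h
      · have hfx : f x = 0 := by
          by_contra hne
          refine hx.2 (Finset.mem_filter.2 ⟨Finset.mem_univ _, ⟨x, ?_, ?_⟩, hne⟩)
          · exact Finset.mem_filter.2 ⟨Finset.mem_univ _, h⟩
          · rw [hTE x x hx.1, if_pos fun _ _ => rfl]
            exact one_ne_zero
        rw [hfx]
        ring
      · rw [hf1 x fun a ha => ?_]
        · ring
        · rw [hTE a x hx.1, if_neg]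
          push Not
          exact hQ a x (Finset.mem_filter.1 ha).2 h)
  have hcount := card_filter_card_le m (2 * 3 * (w * (2 * t) ^ d))
  have hn : 2 ^ (2 * m) = 4 ^ m := by rw [pow_mul]; norm_num
  rw [Finset.card_compl, Fintype.card_fun, Fintype.card_bool, Fintype.card_fin, hn] at hG
  have hE8 : 8 * E.card ≤ 4 ^ m := by
    have h1 : 2 ^ t * (8 * E.card) ≤ 2 ^ t * 4 ^ m := by
      calc 2 ^ t * (8 * E.card) = 8 * (E.card * 2 ^ t) := by ring
        _ ≤ 8 * (C.size * 2 ^ (2 * m)) := Nat.mul_le_mul_left _ hE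
        _ = 8 * C.size * 4 ^ m := by rw [hn]; ring
        _ ≤ 2 ^ t * 4 ^ m := Nat.mul_le_mul_right _ hsize
    exact Nat.le_of_mul_le_mul_left h1 (by positivity)
  have hE8' : 8 * E'.card ≤ 4 ^ m := by rw [← hn, mul_comm]; exact hf2
  have hU := Finset.card_union_le E E'
  set c := 6 * (w * (2 * t) ^ d) + 1
  -- Agreement on at least three quarters of the cube, against at most one half plus `c *
  -- m.centralBinom`, leaves a quarter to be covered by the last term.
  have hlin : 4 ^ m ≤ 4 * (c * m.centralBinom) := by
    change 2 * _ ≤ 4 ^ m + 2 * (c * m.centralBinom) at hcount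
    omega
  have hsq := centralBinom_sq_le m
  have h16 : (16 : ℕ) ^ m = 4 ^ m * 4 ^ m := by rw [← mul_pow]; norm_num
  have hcb : 0 < m.centralBinom := Nat.centralBinom_pos m
  have hfin : m.centralBinom ^ 2 * (2 * m + 1) ≤ m.centralBinom ^ 2 * (16 * c ^ 2) := by
    calc _ ≤ 4 ^ m * 4 ^ m := h16 ▸ hsq
      _ ≤ 4 * (c * m.centralBinom) * (4 * (c * m.centralBinom)) := Nat.mul_le_mul hlin hlin
      _ = _ := by ring
  exact Nat.le_of_mul_le_mul_left hfin (by positivity)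

/-! ### Certificates for positive instances -/

/-- The offset of a block depends only on the lengths of the blocks before it, so one position `p`
serves all `f`. -/
theorem exists_flatMap_position {α β : Type*} (len : α → ℕ) (l : List α) {a : α} (ha : a ∈ l) {i : ℕ}
    (hi : i < len a) : ∃ p : ℕ, ∀ f : α → List β, (∀ b, (f b).length = len b) →
      (l.flatMap f)[p]? = (f a)[i]? := by
  induction l with
  | nil => simp at ha
  | cons b l ih =>
    by_cases hab : a = b
    · subst hab
      refine ⟨i, fun f hf => ?_⟩
      rw [List.flatMap_cons, List.getElem?_append_left (by rwa [hf])]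
    · obtain ⟨p, hp⟩ := ih ((List.mem_cons.1 ha).resolve_left hab)
      refine ⟨len b + p, fun f hf => ?_⟩
      rw [List.flatMap_cons, List.getElem?_append_right (by rw [hf]; omega), hf,
        Nat.add_sub_cancel_left, hp f hf]

theorem length_encodeElt {N : ℕ} (a : Fin N) : (encodeElt a).length = Nat.clog 2 N := by
  simp [encodeElt]

theorem length_table_row {N : ℕ} (g : Fin N → Fin N) :
    ((List.finRange N).flatMap fun b => encodeElt (g b)).length = N * Nat.clog 2 N := by
  simp [List.length_flatMap, length_encodeElt]

theorem length_table {N : ℕ} (mul : Fin N → Fin N → Fin N) :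
    ((List.finRange N).flatMap fun a => (List.finRange N).flatMap fun b =>
      encodeElt (mul a b)).length = N * (N * Nat.clog 2 N) := by
  rw [List.length_flatMap]
  simp only [length_table_row]
  simp

theorem length_encodeCSM {N : ℕ} (mul : Fin N → Fin N → Fin N) (X : Set (Fin N)) (t : Fin N) :
    (encodeCSM mul X t).length = N * (N * Nat.clog 2 N) + N + Nat.clog 2 N := by
  rw [encodeCSM, List.length_append, List.length_append, length_table, length_encodeElt,
    List.length_ofFn]

/-- The length of an encoding determines `N`; hence two instances of equal length have the same
layout. -/
theorem length_encodeCSM_injective :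
    Function.Injective fun N : ℕ => N * (N * Nat.clog 2 N) + N + Nat.clog 2 N := by
  refine StrictMono.injective fun a b hab => ?_
  have h := Nat.clog_mono_right 2 hab.le
  have h2 : a * (a * Nat.clog 2 a) ≤ b * (b * Nat.clog 2 b) :=
    Nat.mul_le_mul hab.le (Nat.mul_le_mul hab.le h)
  omega

theorem exists_table_position {N : ℕ} (a b : Fin N) (j : Fin (Nat.clog 2 N)) :
    ∃ p : ℕ, ∀ (mul : Fin N → Fin N → Fin N) (X : Set (Fin N)) (t : Fin N),
      (encodeCSM mul X t)[p]? = some ((mul a b).val.testBit j) := by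
  obtain ⟨p, hp⟩ := exists_flatMap_position (β := Bool) (fun _ : Fin N => Nat.clog 2 N)
    (List.finRange N) (List.mem_finRange b) j.isLt
  have hpN : p < N * Nat.clog 2 N := by
    have h := hp (fun _ => encodeElt a) fun _ => length_encodeElt a
    rw [List.getElem?_eq_getElem (l := encodeElt a) (by rw [length_encodeElt]; exact j.isLt)] at h
    have := (List.getElem?_eq_some_iff.1 h).1
    rwa [length_table_row fun _ => a] at this
  obtain ⟨q, hq⟩ := exists_flatMap_position (β := Bool) (fun _ : Fin N => N * Nat.clog 2 N)
    (List.finRange N) (List.mem_finRange a) hpN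
  refine ⟨q, fun mul X t => ?_⟩
  have h1 := hq (fun a => (List.finRange N).flatMap fun b => encodeElt (mul a b))
    fun _ => length_table_row _
  have h2 := hp (fun b => encodeElt (mul a b)) fun _ => length_encodeElt _
  have h3 : (encodeElt (mul a b))[j.val]? = some ((mul a b).val.testBit j) := by
    simp [encodeElt]
  rw [h2, h3] at h1
  rw [encodeCSM, List.append_assoc, List.getElem?_append_left, h1]
  exact (List.getElem?_eq_some_iff.1 h1).1

theorem exists_set_position {N : ℕ} (a : Fin N) :
    ∃ p : ℕ, ∀ (mul : Fin N → Fin N → Fin N) (X : Set (Fin N)) (t : Fin N),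
      ∃ b, (encodeCSM mul X t)[p]? = some b ∧ (b = true ↔ a ∈ X) := by
  classical
  refine ⟨N * (N * Nat.clog 2 N) + a, fun mul X t => ⟨decide (a ∈ X), ?_, decide_eq_true_iff⟩⟩
  rw [encodeCSM, List.append_assoc, List.getElem?_append_right (by rw [length_table]; omega),
    length_table, Nat.add_sub_cancel_left, List.getElem?_append_left (by simp)]
  simp

theorem exists_target_position {N : ℕ} (j : Fin (Nat.clog 2 N)) :
    ∃ p : ℕ, ∀ (mul : Fin N → Fin N → Fin N) (X : Set (Fin N)) (t : Fin N),
      (encodeCSM mul X t)[p]? = some (t.val.testBit j) := by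
  refine ⟨N * (N * Nat.clog 2 N) + N + j, fun mul X t => ?_⟩
  rw [encodeCSM, List.getElem?_append_right (by
    rw [List.length_append, length_table, List.length_ofFn]; omega), List.length_append,
    length_table, List.length_ofFn, Nat.add_sub_cancel_left]
  simp [encodeElt]

theorem eq_of_testBit_eq {N : ℕ} {a b : Fin N}
    (h : ∀ j : Fin (Nat.clog 2 N), a.val.testBit j = b.val.testBit j) : a = b := by
  refine Fin.ext (Nat.eq_of_testBit_eq fun j => ?_)
  rcases Nat.lt_or_ge j (Nat.clog 2 N) with hj | hj
  · exact h ⟨j, hj⟩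
  · have hN : ∀ c : Fin N, c.val < 2 ^ j := fun c =>
      c.isLt.trans_le ((Nat.le_pow_clog (by omega) N).trans (Nat.pow_le_pow_right (by omega) hj))
    rw [Nat.testBit_lt_two_pow (hN a), Nat.testBit_lt_two_pow (hN b)]

namespace CayleyCircuit

theorem gateVal_of_eq_none (C : CayleyCircuit) {S : Type u} [Semigroup S] (x : C.InputGate → S)
    {i : Fin C.size} (h : C.gate i = none) : C.gateVal x i = x ⟨i, h⟩ := by
  rw [gateVal]
  split
  · rfl
  · rename_i h'
    rw [h] at h'
    cases h'

theorem gateVal_of_eq_some (C : CayleyCircuit) {S : Type u} [Semigroup S] (x : C.InputGate → S)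
    {i : Fin C.size} {p q : Fin i} (h : C.gate i = some (p, q)) :
    C.gateVal x i =
      C.gateVal x ⟨p, p.isLt.trans i.isLt⟩ * C.gateVal x ⟨q, q.isLt.trans i.isLt⟩ := by
  rw [gateVal]
  split
  · rename_i h'
    rw [h] at h'
    cases h'
  · rename_i p' q' h'
    rw [h] at h'
    cases h'
    rfl

end CayleyCircuit

/-- Few bits of a positive instance certify that it is not a negative instance. -/
theorem exists_certificate {V : SemigroupClass.{u}} {c : ℕ}
    (hV : ∀ (S : Type u) [Semigroup S] [Finite S], V S →
      ∀ (X : Set S) (y : S), y ∈ Subsemigroup.closure X →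
        ∃ C : CayleyCircuit, C.size ≤ (Nat.log 2 (Nat.card S) + 2) ^ c ∧
          ∃ x : C.InputGate → S, (∀ i, x i ∈ X) ∧ C.eval x = y)
    {z : List Bool} (hz : z ∈ (CSM V).yes) :
    ∃ Q : Finset ℕ, Q.card ≤ 2 * (Nat.log 2 z.length + 2) ^ (c + 1) ∧
      ∀ z' ∈ (CSM V).no, z'.length = z.length → ∃ i ∈ Q, z'[i]? ≠ z[i]? := by
  classical
  obtain ⟨S, _, N, e, X, t, hS, ht, rfl⟩ := hz
  have : Finite S := Finite.of_equiv _ e.symm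
  have hN : Nat.card S = N := by rw [Nat.card_congr e, Nat.card_eq_fintype_card, Fintype.card_fin]
  obtain ⟨C, hC, x, hx, hxt⟩ := hV S hS X t ht
  choose P hP using fun a b => exists_table_position (N := N) a b
  choose PX hPX using fun a => exists_set_position (N := N) a
  choose PT hPT using fun j => exists_target_position (N := N) j
  let v : Fin C.size → Fin N := fun i => e (C.gateVal x i)
  -- An input gate is certified by one characteristic bit, a product gate by the bits of the table
  -- entry that it uses.
  let Q : Fin C.size → Finset ℕ := fun i =>
    match C.gate i with
    | none => {PX (v i)}
    | some (p, q) => Finset.univ.image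
        (P (v ⟨p, p.isLt.trans i.isLt⟩) (v ⟨q, q.isLt.trans i.isLt⟩))
  have hlen : (encodeInstance e X t).length = N * (N * Nat.clog 2 N) + N + Nat.clog 2 N :=
    length_encodeCSM _ _ _
  set l := Nat.log 2 (encodeInstance e X t).length
  have hlog : Nat.log 2 N ≤ l := Nat.log_mono_right (by rw [hlen]; omega)
  have hclog : Nat.clog 2 N ≤ l + 1 :=
    (Nat.clog_le_of_le_pow (Nat.lt_pow_succ_log_self (by omega) N).le).trans (by omega)
  refine ⟨Finset.univ.biUnion Q ∪ Finset.univ.image PT, ?_, ?_⟩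
  · have hQ : ∀ i, (Q i).card ≤ l + 1 := by
      intro i
      simp only [Q]
      split
      · simp
      · refine Finset.card_image_le.trans ?_
        simpa using hclog
    have h1 : (Finset.univ.biUnion Q).card ≤ (l + 2) ^ c * (l + 1) := by
      calc (Finset.univ.biUnion Q).card ≤ ∑ i, (Q i).card := Finset.card_biUnion_le
        _ ≤ ∑ i : Fin C.size, (l + 1) := Finset.sum_le_sum fun i _ => hQ i
        _ = C.size * (l + 1) := by simp
        _ ≤ (l + 2) ^ c * (l + 1) := Nat.mul_le_mul_right _ (hC.trans (Nat.pow_le_pow_left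
            (by rw [hN]; omega) c))
    have h2 : (Finset.univ.image PT).card ≤ l + 1 :=
      Finset.card_image_le.trans (by simpa using hclog)
    have h3 : 1 ≤ (l + 2) ^ c := Nat.one_le_pow _ _ (by omega)
    refine (Finset.card_union_le _ _).trans ((add_le_add h1 h2).trans ?_)
    rw [pow_succ]
    nlinarith
  · rintro _ ⟨S', _, N', e', X', t', -, ht', rfl⟩ hlen'
    have hNN : N' = N := length_encodeCSM_injective (by
      dsimp only
      rw [← hlen, ← hlen']
      exact (length_encodeCSM _ _ _).symm)
    subst hNN
    by_contra! hagree
    have hQa : ∀ i, ∀ p ∈ Q i, (encodeInstance e' X' t')[p]? = (encodeInstance e X t)[p]? :=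
      fun i p hp => hagree p (Finset.mem_union_left _ (Finset.mem_biUnion.2
        ⟨i, Finset.mem_univ _, hp⟩))
    -- The same circuit is run in the other semigroup: agreement on the certificate forces its gates
    -- to take the same numbers as values there, all in the generated subsemigroup.
    have key : ∀ m, ∀ i : Fin C.size, i.val = m → e'.symm (v i) ∈ Subsemigroup.closure X' := by
      intro m
      induction m using Nat.strong_induction_on with
      | _ m ih =>
        intro i hi
        have hQi := hQa i
        rcases hg : C.gate i with _ | ⟨p, q⟩
        · simp only [Q, hg, Finset.mem_singleton, forall_eq] at hQi
          refine Subsemigroup.subset_closure ?_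
          obtain ⟨b, hb, hbX⟩ := hPX (v i) (fun a b => e (e.symm a * e.symm b)) (e '' X) (e t)
          obtain ⟨b', hb', hbX'⟩ :=
            hPX (v i) (fun a b => e' (e'.symm a * e'.symm b)) (e' '' X') (e' t')
          have hbb : some b' = some b := hb'.symm.trans (hQi.trans hb)
          have hv : v i ∈ e '' X := ⟨_, hx ⟨i, hg⟩, by
            simp only [v, C.gateVal_of_eq_none x hg]⟩
          rw [← hbX, ← Option.some.inj hbb, hbX'] at hv
          obtain ⟨y, hy, hyv⟩ := hv
          rw [← hyv, e'.symm_apply_apply]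
          exact hy
        · set p' : Fin C.size := ⟨p, p.isLt.trans i.isLt⟩
          set q' : Fin C.size := ⟨q, q.isLt.trans i.isLt⟩
          have hvi : e' (e'.symm (v p') * e'.symm (v q')) = v i := by
            have h1 : v i = e (e.symm (v p') * e.symm (v q')) := by
              simp only [v, e.symm_apply_apply, C.gateVal_of_eq_some x hg, p', q']
            rw [h1]
            refine eq_of_testBit_eq fun j => ?_
            have h2 := hQi (P (v p') (v q') j) (by
              simp only [Q, hg]
              exact Finset.mem_image_of_mem _ (Finset.mem_univ j))
            have h3 := hP (v p') (v q') j (fun a b => e (e.symm a * e.symm b)) (e '' X) (e t)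
            have h4 := hP (v p') (v q') j (fun a b => e' (e'.symm a * e'.symm b)) (e' '' X') (e' t')
            exact Option.some.inj (h4.symm.trans (h2.trans h3))
          rw [← hvi, e'.symm_apply_apply]
          exact mul_mem (ih p (hi ▸ p.isLt) p' rfl) (ih q (hi ▸ q.isLt) q' rfl)
    refine ht' ?_
    have htt : e' t' = e t := eq_of_testBit_eq fun j => by
      have h2 := hagree (PT j) (Finset.mem_union_right _ (Finset.mem_image_of_mem _
        (Finset.mem_univ j)))
      have h3 := hPT j (fun a b => e (e.symm a * e.symm b)) (e '' X) (e t)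
      have h4 := hPT j (fun a b => e' (e'.symm a * e'.symm b)) (e' '' X') (e' t')
      exact Option.some.inj (h4.symm.trans (h2.trans h3))
    have hout := key _ ⟨C.size - 1, Nat.sub_lt C.size_pos Nat.one_pos⟩ rfl
    have hvt : v ⟨C.size - 1, Nat.sub_lt C.size_pos Nat.one_pos⟩ = e' t' := by
      rw [htt, ← hxt]
      rfl
    rwa [hvt, e'.symm_apply_apply] at hout

/-! ### The lower bound -/

theorem exists_pow_lt_two_pow (K E : ℕ) : ∃ l, 1 ≤ l ∧ (l + K) ^ E < 2 ^ l := by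
  have h := tendsto_pow_const_div_const_pow_of_one_lt E (r := (2 : ℝ)) (by norm_num)
  -- With `u = l + K`, the bound `1 / 2 ^ K` absorbs the shift between `2 ^ u` and `2 ^ l`.
  have h2 := (h.eventually (gt_mem_nhds (show (0 : ℝ) < 1 / 2 ^ K by positivity))).and
    (Filter.eventually_ge_atTop (K + 1))
  obtain ⟨u, hu, hK⟩ := h2.exists
  refine ⟨u - K, by omega, ?_⟩
  rw [Nat.sub_add_cancel (by omega)]
  rw [div_lt_div_iff₀ (by positivity) (by positivity), one_mul] at hu
  have hu' : u ^ E * 2 ^ K < 2 ^ u := by exact_mod_cast hu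
  have e : 2 ^ u = 2 ^ (u - K) * 2 ^ K := by rw [← pow_add, Nat.sub_add_cancel (by omega)]
  rw [e] at hu'
  exact Nat.lt_of_mul_lt_mul_right hu'

theorem pow_add_le_two_pow (l k : ℕ) : (2 ^ l) ^ k + k ≤ 2 ^ (k * l + k) := by
  have h1 : k < 2 ^ k := Nat.lt_two_pow_self
  have h2 : 1 ≤ (2 ^ l) ^ k := Nat.one_le_pow _ _ (by positivity)
  calc (2 ^ l) ^ k + k ≤ (2 ^ l) ^ k * (k + 1) := by nlinarith
    _ ≤ (2 ^ l) ^ k * 2 ^ k := Nat.mul_le_mul_left _ h1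
    _ = 2 ^ (k * l + k) := by rw [← pow_mul, ← pow_add, mul_comm l k]

/-- A polylogarithmic quantity is eventually smaller than the input length. -/
theorem exists_polylog_lt (k c d : ℕ) : ∃ l, 1 ≤ l ∧
    16 * (6 * (2 * (k * l + k + 2) ^ (c + 1) * (2 * (k * l + k + 3)) ^ d) + 1) ^ 2 < 2 ^ l := by
  -- Each quantity is bounded by a power of `u = l + (k + 16)`: `u ^ 2` and `u ^ 3` for the two
  -- bases, one factor `u` for the constants inside the square, and one for the leading 16.
  obtain ⟨l, hl, h⟩ := exists_pow_lt_two_pow (k + 16) (2 * (1 + (2 * (c + 1) + 3 * d)) + 1)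
  refine ⟨l, hl, lt_of_le_of_lt ?_ h⟩
  set u := l + (k + 16)
  have hu : 16 ≤ u := by omega
  have h1 : k * l + k + 3 ≤ u ^ 2 := by
    simp only [u]
    nlinarith [Nat.zero_le (k * l)]
  have h2 : 2 * (k * l + k + 3) ≤ u ^ 3 := by
    rw [pow_succ, mul_comm]
    exact Nat.mul_le_mul h1 (by omega)
  have h3 : (k * l + k + 2) ^ (c + 1) * (2 * (k * l + k + 3)) ^ d ≤
      u ^ (2 * (c + 1) + 3 * d) := by
    rw [pow_add u, pow_mul u, pow_mul u]
    exact Nat.mul_le_mul (Nat.pow_le_pow_left (by omega) _) (Nat.pow_le_pow_left h2 _)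
  have h4 : 6 * (2 * (k * l + k + 2) ^ (c + 1) * (2 * (k * l + k + 3)) ^ d) + 1 ≤
      u ^ (1 + (2 * (c + 1) + 3 * d)) := by
    rw [pow_add u 1, pow_one, mul_assoc 2]
    have : 1 ≤ u ^ (2 * (c + 1) + 3 * d) := Nat.one_le_pow _ _ (by omega)
    nlinarith
  calc _ ≤ u * (u ^ (1 + (2 * (c + 1) + 3 * d))) ^ 2 :=
        Nat.mul_le_mul hu (Nat.pow_le_pow_left h4 2)
    _ = u ^ (2 * (1 + (2 * (c + 1) + 3 * d)) + 1) := by ring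

/-- The certificates of the positive instances produced from odd words meet the hypotheses of
`le_of_parity_certificates`, whose conclusion fails at a suitable input length `2 ^ l`. -/
theorem not_AC0Reduces_parity {V : SemigroupClass.{u}} (hV : HasPolylogCircuits V) :
    ¬ AC0Reduces Parity (CSM V) := by
  classical
  rintro ⟨f, ⟨M, C, d, k, hC, hf⟩, hred⟩
  obtain ⟨c, hV⟩ := hV
  obtain ⟨l, hl, hlt⟩ := exists_polylog_lt k c d
  obtain ⟨r, rfl⟩ : ∃ r, l = r + 1 := ⟨l - 1, by omega⟩
  have hn : 2 ^ (r + 1) = 2 * 2 ^ r := pow_succ' 2 r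
  set m := 2 ^ r
  obtain ⟨hAC, hd, hs, hM⟩ := hC (2 * m)
  have hbound : (2 * m) ^ k + k ≤ 2 ^ (k * (r + 1) + k) := by
    rw [← hn]
    exact pow_add_le_two_pow _ _
  have hfx : ∀ x : Fin (2 * m) → Bool, f (List.ofFn x) = List.ofFn ((C (2 * m)).eval x) := by
    have aux : ∀ w : List Bool, ∀ n (hw : w.length = n), f w =
        List.ofFn ((C n).eval fun i => w.get (i.cast hw.symm)) := by
      rintro w _ rfl
      exact hf w
    intro x
    rw [aux _ (2 * m) (List.length_ofFn)]
    congr 2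
    funext i
    simp
  have hpar : ∀ x : Fin (2 * m) → Bool,
      List.ofFn x ∈ Parity ↔ Odd (Finset.univ.filter fun j => x j = true).card := by
    have aux : ∀ w : List Bool, ∀ n (hw : w.length = n), w ∈ Parity ↔
        Odd (Finset.univ.filter fun j : Fin n => w.get (j.cast hw.symm) = true).card := by
      rintro w _ rfl
      change Odd (w.count true) ↔ _
      rw [count_true_eq_card]
      rfl
    intro x
    rw [aux _ (2 * m) (List.length_ofFn)]
    simp
  have hcert : ∀ a : Fin (2 * m) → Bool, ∃ Q : Finset (Fin (M (2 * m))),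
      Q.card ≤ 2 * (k * (r + 1) + k + 2) ^ (c + 1) ∧
      (Odd (Finset.univ.filter fun j => a j = true).card → ∀ x : Fin (2 * m) → Bool,
        ¬ Odd (Finset.univ.filter fun j => x j = true).card →
        ∃ j ∈ Q, (C (2 * m)).eval x j ≠ (C (2 * m)).eval a j) := by
    intro a
    by_cases ha : Odd (Finset.univ.filter fun j => a j = true).card
    · obtain ⟨Q, hQ, h⟩ := exists_certificate hV ((hred _).1 ((hpar a).2 ha))
      rw [hfx, List.length_ofFn] at hQ
      refine ⟨Finset.univ.filter fun j => j.val ∈ Q, ?_, fun _ x hx => ?_⟩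
      · have hlog : Nat.log 2 (M (2 * m)) ≤ k * (r + 1) + k := by
          rw [← Nat.log_pow (b := 2) (by omega) (k * (r + 1) + k)]
          exact Nat.log_mono_right (hM.trans hbound)
        have h1 : (Finset.univ.filter fun j : Fin (M (2 * m)) => j.val ∈ Q).card ≤ Q.card :=
          Finset.card_le_card_of_injOn Fin.val (fun j hj => (Finset.mem_filter.1 hj).2)
            Fin.val_injective.injOn
        exact h1.trans (hQ.trans (Nat.mul_le_mul_left _ (Nat.pow_le_pow_left (by omega) _)))
      -- Words of equal length have images of equal length, so the certificate of the image of `a`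
      -- applies to that of `x`.
      · obtain ⟨i, hi, hne⟩ := h (f (List.ofFn x)) ((hred _).2 (mt (hpar x).1 hx))
          (by rw [hfx, hfx, List.length_ofFn, List.length_ofFn])
        rw [hfx, hfx, List.getElem?_ofFn, List.getElem?_ofFn] at hne
        by_cases hiM : i < M (2 * m)
        · refine ⟨⟨i, hiM⟩, Finset.mem_filter.2 ⟨Finset.mem_univ _, hi⟩, fun h' => hne ?_⟩
          rw [dif_pos hiM, dif_pos hiM, h']
        · rw [dif_neg hiM, dif_neg hiM] at hne
          exact absurd rfl hne
    · exact ⟨∅, by simp, fun h => absurd h ha⟩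
  choose Q hQ hQ' using hcert
  -- The additional 3 in the exponent pays for the factor 8, which keeps the approximation error of
  -- the circuit below one eighth.
  have hsize : 8 * (C (2 * m)).size ≤ 2 ^ (k * (r + 1) + k + 3) := by
    rw [pow_add, mul_comm]
    exact Nat.mul_le_mul (hs.trans hbound) (by norm_num)
  have hfinal := le_of_parity_certificates (Nat.succ_pos _) (C (2 * m)) hAC hd hsize Q hQ
    fun a x ha hx => hQ' a ha x hx
  rw [hn] at hlt
  exact absurd hlt (not_lt.2 ((Nat.le_succ _).trans hfinal))

end CayleySemigroup

theorem mainTheorem4 :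
    (∀ V : CayleySemigroup.SemigroupClass.{u}, CayleySemigroup.HasPolylogCircuits V →
      ∀ K : Set (Language Bool), CayleySemigroup.Parity ∈ K →
        ¬ CayleySemigroup.IsHardFor (CayleySemigroup.CSM V) K) ∧
    CayleySemigroup.HasPolylogCircuits CayleySemigroup.groupClass.{u} ∧
    CayleySemigroup.HasPolylogCircuits CayleySemigroup.comClass.{u} ∧
    CayleySemigroup.Parity ∈ CayleySemigroup.ACC0 ∧
    CayleySemigroup.Parity ∈ CayleySemigroup.TC0 ∧
    CayleySemigroup.Parity ∈ CayleySemigroup.NC1 ∧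
    CayleySemigroup.Parity ∈ CayleySemigroup.Logspace ∧
    CayleySemigroup.Parity ∈ CayleySemigroup.NLogspace :=
  ⟨fun _ hV _ hK hhard => CayleySemigroup.not_AC0Reduces_parity hV (hhard _ hK),
    CayleySemigroup.hasPolylogCircuits_groupClass, CayleySemigroup.hasPolylogCircuits_comClass,
    CayleySemigroup.parity_mem_ACC0, CayleySemigroup.parity_mem_TC0,
    CayleySemigroup.parity_mem_NC1, CayleySemigroup.parity_mem_Logspace,
    CayleySemigroup.parity_mem_NLogspace⟩
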